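/- **Setting.** *Plant.* States are $x=[p,q]\in\mathbb R^{n_p}\times\mathbb R^{n_q}$; the system is $\dot x=f(x)+g(x)u$ with $f,g$ Lipschitz (solutions in the sense of Carathéodory). Let $T>0$, $\mathcal U=\mathcal U_l\oplus\mathcal U_m$, $\mathcal X_q\subset\mathbb R^{n_q}$, $\mathcal X_p\subset\mathbb R^{n_p}$ (free space), and let the reference model be $\dot{\bar x}=A_i\bar x+B_iu_m$ on $(iT,(i+1)T)$ with $u_m$ constant there, with exact discretization $\bar A_i=e^{A_iT}$, $\bar B_i=\int_0^Te^{A_i(T-\eta)}B_i\,d\eta$. Let $\mathcal E=\{e:h_e(e)\ge0\}$ with $h_e\in C^1$, $h_e(0)\ge 0$, and $V(e)=e^\top Qe$. *Low level.* With $e=x-\bar x$ and $f_e=f(x)+g(x)(v+u_m)-A_i\bar x-B_iu_m$, the CLF–CBF QP minimizes $\|v\|_2+c_1\gamma^2$ over $v\in\mathcal U_l$, $\gamma\in\mathbb R$ subject to $\nabla V(e)f_e\le-c_2V(e)+\gamma$ and $\nabla h_e(e)f_e\ge-\alpha(h_e(e))$, where $c_1,c_2\ge0$ and $\alpha$ is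 strictly increasing with $\alpha(0)=0$; the low-level input $u_l(t)$ is the $v$-part of a minimizer. *Planner.* For a current cell $C$, a goal cell $C'$ and a goal position $p'$, write $\mathcal X(C)=\{x: p\in C,\ f(x)=0\}$ and $\mathcal E_p=\{[e_p,0]:\exists e_q,\,[e_p,e_q]\in\mathcal E\}$, and let $\ominus$ be the Pontryagin difference. The MPC problem at $iT$ with horizon $n$ minimizes $\|x_i^d-x(iT)\|_{Q_e}+\sum_{t=i}^{i+n-1}\ell(x^d_t,v_t)+\|p^d_{i+n}-p'\|_{Q_f}$ over $x^d_i$ and $v_i,\dots,v_{i+n-1}$ subject to $x^d_{t+1}=\bar A_tx_t^d+\bar B_tv_t$, $x_t^d\in\{x:p\in C\cup C',\,q\in\mathcal X_q\}\ominus\mathcal E$, $v_t\in\mathcal U_m$ ($i\le t<i+n$), $x(iT)-x_i^d\in\mathcal E$, and $x^d_{i+n}\in\mathcal X(C')\ominus\mathcal E_p$. (Here $\|y\|_Q=y^\top Qy$.) *High level.* A finite MOMDP $(\mathcal S,\mathcal Z,\mathcal A,\mathcal O,T_s,T_z,O)$ with deterministic observable transition $s'=f_s(s,z,a)$; each $s$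 stands for a cell $\mathcal C(s)\subset\mathbb R^{n_p}$, the cells being pairwise disjoint. $\psi$ is an scLTL formula over the sequence $\omega_k=(s_k,z_k)$, and $\mathbb P^\pi[\omega\models\psi]$ is the probability of $\psi$ for the MOMDP started from $s_0$, $o_0$, $z_0\sim b_0$ under a policy $\pi$ acting on the observed history $(s_0,o_0,\dots,s_k,o_k)$. The high-level policy $a_k=\pi_h(s_k,b_k)$, where $b_k$ is the Bayesian belief, maximizes $\mathbb P^\pi[\omega\models\psi]$ over a class $\Pi$ of such policies with $\pi_h\in\Pi$. *Closed loop.* Update number $k=0$ of the high level is made at time $0$, and update $k+1$ at the first sampling time $iT$ after update $k$ at which $p(iT)\in\mathcal C^k_{\rm goal}$. At update $k$: $s_k$ is the cell index of the position, $\mathcal C_{\rm curr}^k=\mathcal C(s_k)$, $b_k$ is obtained by the belief update from the new observation $o_k$ (for $k=0$ it is $b_0$), $a_k=\pi_h(s_k,b_k)$, $\hat z_k\in\arg\max_z b_k^{(z)}$, $\mathcal C_{\rm goal}^k=\mathcal C(s_k^+)$ with $s_k^+=f_s(s_k,\hat z_k,a_k)$, and $p^k_{\rm goal}$ is a point of the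 closure of $\mathcal C^k_{\rm goal}$ nearest to the center of the cell of $f_s(s_k^+,\hat z_k,\pi_h(s_k^+,b_k))$; the horizon $N^k$ is set to $N\ge1$. At each $iT$, with $k$ the latest update, the MPC problem with the data of $k$ and horizon $N^k$ is solved; if it is infeasible, the contingency problem with the data of $k-1$ and horizon $N^{k-1}$ is solved instead. The horizon of the problem that was solved is replaced by $\max(1,\cdot-1)$. The first state and the first input of the optimal plan become $\bar x(iT)$ and $u_m$ on $[iT,(i+1)T)$, and $u=u_l+u_m$. An execution stops only at a time at which the QP is infeasible, or at which both MPC problems are infeasible (for $k=0$: the only one). The environment $(z_k,o_k)$ is random: $z_0\sim b_0$, and, given the history up to update $k$, $a_k$, and the cell $s_{k+1}$ in which the system is at update $k+1$, $z_{k+1}$ and $o_{k+1}$ are drawn from $T_z(s_k,z_k,a_k,s_{k+1},\cdot)$ and $O(s_{k+1},z_{k+1},a_k,\cdot)$. **Theorem.** Assume, almost surely where an execution is involved: (1) the QP is feasible for all $x-\bar x\in\mathcal E$, all $u_m\in\mathcal U_m$ and all $i$; (2) for every update $k$ that takes place, every $i$ and every measured state in $\mathcal X(\mathcal C_{\rm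 curr}^k)\oplus\mathcal E$, the MPC problem with the data of $k$ and horizon $N$ is feasible; (3) $\mathcal C^k_{\rm goal}\subset\mathcal X_p$ for every such $k$, and $\mathcal C^0_{\rm curr}\subset\mathcal X_p$; (4) if at $iT$, with $k$ the latest update, the MPC problem with the data of $k$ is infeasible (so that the contingency plan towards $\mathcal C_{\rm goal}^{k-1}$ is executed), then $p((i+1)T)\notin\mathcal C^k_{\rm goal}$; and $x(0)\in\mathcal X(\mathcal C^0_{\rm curr})\oplus\mathcal E$, $p(0)\in\mathcal C(s_0)$. Then, almost surely, the execution never stops; at each $iT$ the MPC problem or the contingency problem is feasible; $p(iT)\in\mathcal X_p$, $q(iT)\in\mathcal X_q$ for all $i$ and $u(t)\in\mathcal U$ for all $t\ge0$; and for every $k$ the update $k$ takes place and the system is in $\mathcal C^k_{\rm goal}$ at some later sampling time, so that every goal cell is reached in finite time. If moreover, almost surely, the cell selected with the maximum likelihood estimate is the MOMDP successor, i.e. $f_s(s_k,\hat z_k,a_k)=f_s(s_k,z_k,a_k)$ for all updates $k$ that take place, then the closed-loop sequence $(s_k,z_k,o_k)_{k\ge0}$ has the law of the MOMDP under $\pi_h$,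 and the probability that the closed loop satisfies $\psi$ is $\max_{\pi\in\Pi}\mathbb P^\pi[\omega\models\psi]$. -/

import Mathlib

open MeasureTheory ProbabilityTheory Set
open scoped Pointwise

namespace MultiRate

noncomputable section

/-! ### Continuous system, reference model and low-level controller -/

/-- Positions `p`. -/
abbrev Pos (np : ℕ) := EuclideanSpace ℝ (Fin np)

/-- States `x = [p, q]` with the Euclidean norm of the stacked vector. -/
abbrev State (np nq : ℕ) := EuclideanSpace ℝ (Fin np ⊕ Fin nq)

/-- The position part `p` of `x = [p, q]`. -/
def pos {np nq : ℕ} (x : State np nq) : Pos np := WithLp.toLp 2 fun j => x (Sum.inl j)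

/-- The remaining part `q` of `x = [p, q]`. -/
def rest {np nq : ℕ} (x : State np nq) : EuclideanSpace ℝ (Fin nq) :=
  WithLp.toLp 2 fun j => x (Sum.inr j)

/-- Inputs. -/
abbrev Input (nu : ℕ) := EuclideanSpace ℝ (Fin nu)

/-- The data of the low and middle layers. -/
structure Plant (np nq nu : ℕ) where
  /-- drift of the control-affine system `x' = f x + g x u` -/
  f : State np nq → State np nq
  /-- input matrix of the control-affine system -/
  g : State np nq → Input nu →L[ℝ] State np nq
  f_lipschitz : ∃ K, LipschitzWith K f
  g_lipschitz : ∃ K, LipschitzWith K g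
  /-- sampling period -/
  T : ℝ
  T_pos : 0 < T
  /-- matrices of the reference model, constant on `[iT, (i+1)T)` -/
  A : ℕ → State np nq →L[ℝ] State np nq
  B : ℕ → Input nu →L[ℝ] State np nq
  /-- low-level and mid-level input constraint sets -/
  Ul : Set (Input nu)
  Um : Set (Input nu)
  /-- constraint set of the non-position part of the state -/
  Xq : Set (EuclideanSpace ℝ (Fin nq))
  /-- barrier function of the tracking error -/
  he : State np nq → ℝ
  he_smooth : ContDiff ℝ 1 he
  he_zero : 0 ≤ he 0
  /-- extended class-K function -/
  α : ℝ → ℝ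
  α_strictMono : StrictMono α
  α_zero : α 0 = 0
  /-- weight of the candidate Lyapunov function -/
  Q : State np nq →L[ℝ] State np nq
  c₁ : ℝ
  c₁_nonneg : 0 ≤ c₁
  c₂ : ℝ
  c₂_nonneg : 0 ≤ c₂
  /-- stage cost and weights of the planner -/
  stageCost : State np nq → Input nu → ℝ
  Qe : State np nq →L[ℝ] State np nq
  Qf : Pos np →L[ℝ] Pos np

/-- `‖e‖_Q = eᵀ Q e`. -/
def quad {E : Type*} [NormedAddCommGroup E] [InnerProductSpace ℝ E] (Q : E →L[ℝ] E) (e : E) : ℝ :=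
  inner ℝ e (Q e)

/-- Pontryagin difference. -/
def pontryagin {E : Type*} [Add E] (X Y : Set E) : Set E := {x | ∀ y ∈ Y, x + y ∈ X}

namespace Plant

variable {np nq nu : ℕ} (P : Plant np nq nu)

/-- The input constraint set `U = Uₗ ⊕ Uₘ`. -/
def U : Set (Input nu) := P.Ul + P.Um

/-- The safe set of the tracking error. -/
def E : Set (State np nq) := {e | 0 ≤ P.he e}

/-- The set `E_p` of the errors in `E` with their non-position part replaced by `0`. -/
def Ep : Set (State np nq) := {e | ∃ e' ∈ P.E, pos e = pos e' ∧ rest e = 0}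

/-- Candidate Lyapunov function. -/
def V (e : State np nq) : ℝ := quad P.Q e

/-- Error dynamics on `[iT, (i+1)T)`. -/
def errorField (i : ℕ) (x xbar : State np nq) (ul um : Input nu) : State np nq :=
  P.f x + P.g x (ul + um) - (P.A i xbar + P.B i um)

/-- `(v, γ)` satisfies the constraints of the CLF-CBF quadratic program. -/
def QPConstraints (i : ℕ) (x xbar : State np nq) (um v : Input nu) (γ : ℝ) : Prop :=
  v ∈ P.Ul ∧
  fderiv ℝ P.V (x - xbar) (P.errorField i x xbar v um) ≤ -P.c₂ * P.V (x - xbar) + γ ∧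
  -P.α (P.he (x - xbar)) ≤ fderiv ℝ P.he (x - xbar) (P.errorField i x xbar v um)

def QPFeasible (i : ℕ) (x xbar : State np nq) (um : Input nu) : Prop :=
  ∃ v γ, P.QPConstraints i x xbar um v γ

/-- `v` is the input part of a minimizer of the CLF-CBF quadratic program. -/
def IsQPSolution (i : ℕ) (x xbar : State np nq) (um v : Input nu) : Prop :=
  ∃ γ, P.QPConstraints i x xbar um v γ ∧
    ∀ v' γ', P.QPConstraints i x xbar um v' γ' →
      ‖v‖ + P.c₁ * γ ^ 2 ≤ ‖v'‖ + P.c₁ * γ' ^ 2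

/-- The QP is feasible for every error in the safe set and every admissible mid-level input. -/
def QPFeasibilityAssumption : Prop :=
  ∀ (i : ℕ) (x xbar : State np nq), x - xbar ∈ P.E → ∀ um ∈ P.Um, P.QPFeasible i x xbar um

/-! ### Mid-level planner -/

/-- Exact discretization of the reference model. -/
def Abar (i : ℕ) : State np nq →L[ℝ] State np nq := NormedSpace.exp (P.T • P.A i)

def Bbar (i : ℕ) : Input nu →L[ℝ] State np nq :=
  ∫ η in (0 : ℝ)..P.T, (NormedSpace.exp ((P.T - η) • P.A i) : State np nq →L[ℝ] State np nq) ∘L P.B i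

/-- Unforced equilibria with position in the cell `C`. -/
def equilibria (C : Set (Pos np)) : Set (State np nq) := {x | pos x ∈ C ∧ P.f x = 0}

end Plant

/-- The time-varying components of the planning problem issued by the high level: current cell,
goal cell, goal position. -/
structure Goal (np : ℕ) where
  curr : Set (Pos np)
  goal : Set (Pos np)
  pgoal : Pos np

/-- A planned trajectory: states `x_{i+t|i}` and inputs `v_{i+t|i}`, indexed by `t`. Only the
entries up to the horizon matter. -/
structure Plan (np nq nu : ℕ) where
  x : ℕ → State np nq
  v : ℕ → Input nu

namespace Plant

variable {np nq nu : ℕ} (P : Plant np nq nu)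

/-- States with position in the current or the goal cell and `q ∈ Xq`. -/
def Xpq (c : Goal np) : Set (State np nq) := {x | pos x ∈ c.curr ∪ c.goal ∧ rest x ∈ P.Xq}

/-- Constraints of the planning problem at sampling index `i`, with horizon `n` and measured
state `x₀`. -/
def MPCConstraints (i n : ℕ) (c : Goal np) (x₀ : State np nq) (p : Plan np nq nu) : Prop :=
  (∀ t < n, p.x (t + 1) = P.Abar (i + t) (p.x t) + P.Bbar (i + t) (p.v t)) ∧
  (∀ t < n, p.x t ∈ pontryagin (P.Xpq c) P.E ∧ p.v t ∈ P.Um) ∧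
  x₀ - p.x 0 ∈ P.E ∧
  p.x n ∈ pontryagin (P.equilibria c.goal) P.Ep

/-- Cost of the planning problem. -/
def MPCCost (n : ℕ) (c : Goal np) (x₀ : State np nq) (p : Plan np nq nu) : ℝ :=
  quad P.Qe (p.x 0 - x₀) + ∑ t ∈ Finset.range n, P.stageCost (p.x t) (p.v t)
    + quad P.Qf (pos (p.x n) - c.pgoal)

def MPCFeasible (i n : ℕ) (c : Goal np) (x₀ : State np nq) : Prop :=
  ∃ p : Plan np nq nu, P.MPCConstraints i n c x₀ p

def IsMPCSolution (i n : ℕ) (c : Goal np) (x₀ : State np nq) (p : Plan np nq nu) : Prop :=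
  P.MPCConstraints i n c x₀ p ∧
    ∀ p' : Plan np nq nu, P.MPCConstraints i n c x₀ p' → P.MPCCost n c x₀ p ≤ P.MPCCost n c x₀ p'

end Plant

/-! ### Specifications -/

/-- Syntactically co-safe LTL formulas. -/
inductive SCLTL (AP : Type*) where
  | atom (p : AP) : SCLTL AP
  | natom (p : AP) : SCLTL AP
  | and (φ ψ : SCLTL AP) : SCLTL AP
  | or (φ ψ : SCLTL AP) : SCLTL AP
  | untl (φ ψ : SCLTL AP) : SCLTL AP
  | next (φ : SCLTL AP) : SCLTL AP

/-- `Sat label w ψ k`: the suffix of `w` that starts at `k` satisfies `ψ`. -/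
def Sat {AP W : Type*} (label : AP → Set W) (w : ℕ → W) : SCLTL AP → ℕ → Prop
  | .atom p, k => w k ∈ label p
  | .natom p, k => w k ∉ label p
  | .and φ ψ, k => Sat label w φ k ∧ Sat label w ψ k
  | .or φ ψ, k => Sat label w φ k ∨ Sat label w ψ k
  | .untl φ ψ, k => ∃ l, k ≤ l ∧ Sat label w ψ l ∧ ∀ j, k ≤ j → j < l → Sat label w φ j
  | .next φ, k => Sat label w φ (k + 1)

/-! ### The mixed observable Markov decision process -/

/-- A MOMDP: the observable state moves deterministically given `(s, z, a)`. -/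
structure MOMDP (S Z A O : Type*) where
  fs : S → Z → A → S
  /-- `Tz s z a s'` is the law of `z'` -/
  Tz : S → Z → A → S → PMF Z
  /-- `Obs s' z' a` is the law of the observation made after arriving in `(s', z')` by `a` -/
  Obs : S → Z → A → PMF O

/-- A policy maps the observed history, listed from the most recent pair `(s_k, o_k)` back to
`(s_0, o_0)`, to an action. -/
abbrev Policy (S A O : Type*) := List (S × O) → A

/-- `[y_n, …, y_0]` -/
def historyList {Y : Type*} (y : ℕ → Y) : ℕ → List Y
  | 0 => [y 0]
  | n + 1 => y (n + 1) :: historyList y n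

namespace MOMDP

variable {S Z A O : Type*} (M : MOMDP S Z A O)

open Classical in
/-- The indicator `T_s`. -/
def Ts (s : S) (z : Z) (a : A) (s' : S) : ℝ := if s' = M.fs s z a then 1 else 0

/-- Unnormalized posterior. -/
def beliefWeight [Fintype Z] (s' s : S) (o : O) (a : A) (b : Z → ℝ) (z' : Z) : ℝ :=
  (M.Obs s' z' a o).toReal * ∑ z, M.Ts s z a s' * (M.Tz s z a s' z').toReal * b z

/-- The belief update `f_b`. -/
def beliefUpdate [Fintype Z] (s' s : S) (o : O) (a : A) (b : Z → ℝ) : Z → ℝ :=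
  fun z' => M.beliefWeight s' s o a b z' / ∑ z'', M.beliefWeight s' s o a b z''

/-- The belief computed along an observed history when the actions are those of the
belief-feedback policy `πh`. -/
def beliefAlong [Fintype Z] (b₀ : PMF Z) (πh : S → (Z → ℝ) → A) : List (S × O) → (Z → ℝ)
  | [] => fun z => (b₀ z).toReal
  | [_] => fun z => (b₀ z).toReal
  | y' :: y :: l =>
      M.beliefUpdate y'.1 y.1 y'.2 (πh y.1 (beliefAlong b₀ πh (y :: l)))
        (beliefAlong b₀ πh (y :: l))

/-- The belief-feedback policy `a_k = πh (s_k, b_k)` as a function of the observed history.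
Histories are never empty; `s₀` only fills that case. -/
def beliefPolicy [Fintype Z] (s₀ : S) (b₀ : PMF Z) (πh : S → (Z → ℝ) → A) : Policy S A O
  | [] => πh s₀ (M.beliefAlong b₀ πh [])
  | y :: l => πh y.1 (M.beliefAlong b₀ πh (y :: l))

/-- Law of the next `(s', z', o')`. -/
def stepLaw (s : S) (z : Z) (a : A) : PMF (S × Z × O) :=
  (M.Tz s z a (M.fs s z a)).bind fun z' =>
    (M.Obs (M.fs s z a) z' a).map fun o' => (M.fs s z a, z', o')

section Law

variable [Fintype S] [Fintype Z] [Fintype O]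
  [MeasurableSpace S] [MeasurableSpace Z] [MeasurableSpace O]
  [MeasurableSingletonClass S] [MeasurableSingletonClass Z] [MeasurableSingletonClass O]

/-- Transition kernel from the history `(s_j, z_j, o_j)`, `j ≤ n`, to `(s_{n+1}, z_{n+1}, o_{n+1})`
under the policy `π`, which sees only the pairs `(s_j, o_j)`. -/
def stepKernel (π : Policy S A O) (n : ℕ) :
    Kernel ((_ : Finset.Iic n) → S × Z × O) (S × Z × O) :=
  Kernel.ofFunOfCountable fun h =>
    (M.stepLaw (h ⟨n, by simp⟩).1 (h ⟨n, by simp⟩).2.1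
      (π (historyList (fun j => ((h ⟨min j n, by simp⟩).1, (h ⟨min j n, by simp⟩).2.2)) n))).toMeasure

instance (π : Policy S A O) (n : ℕ) : IsMarkovKernel (M.stepKernel π n) :=
  ⟨fun h => by unfold stepKernel Kernel.ofFunOfCountable; exact PMF.toMeasure.isProbabilityMeasure _⟩

/-- The law of the trajectory `(s_k, z_k, o_k)` of the MOMDP under the policy `π`, started from
`s₀` with first observation `o₀` and `z₀` distributed as the belief `b₀` held after `o₀`. -/
def law (s₀ : S) (b₀ : PMF Z) (o₀ : O) (π : Policy S A O) : Measure (ℕ → S × Z × O) :=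
  Kernel.trajMeasure (X := fun _ => S × Z × O) (b₀.map fun z => (s₀, z, o₀)).toMeasure (M.stepKernel π)

/-- `P^π[ω ⊨ ψ]` with `ω_k = (s_k, z_k)`. -/
def satProb {AP : Type*} (label : AP → Set (S × Z)) (ψ : SCLTL AP) (s₀ : S) (b₀ : PMF Z) (o₀ : O)
    (π : Policy S A O) : ENNReal :=
  M.law s₀ b₀ o₀ π {w | Sat label (fun k => ((w k).1, (w k).2.1)) ψ 0}

end Law

end MOMDP

/-! ### The multi-rate closed loop -/

/-- The parameters of the high level and the planning horizon. Each observable state `s` stands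
for the grid cell `cell s`; the cells are pairwise disjoint. -/
structure HighLevel (np : ℕ) (S Z A O : Type*) where
  M : MOMDP S Z A O
  cell : S → Set (Pos np)
  cell_disjoint : Pairwise fun s s' => Disjoint (cell s) (cell s')
  /-- cell centers -/
  center : S → Pos np
  /-- the high-level policy -/
  πh : S → (Z → ℝ) → A
  /-- the belief held at time `0` -/
  b₀ : PMF Z
  /-- the planning horizon -/
  N : ℕ
  N_pos : 1 ≤ N

/-- All signals of an execution. It lives on `[0, θ]`, with `θ = ⊤` for an execution that never
stops. High-level updates are numbered `k = 0, 1, …`, the update `0` being made at time `0`;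
quantities with index `k` are meaningful only for updates that take place. -/
structure Run (np nq nu : ℕ) (S Z A : Type*) where
  θ : EReal
  x : ℝ → State np nq
  xbar : ℝ → State np nq
  ul : ℝ → Input nu
  /-- mid-level input on `[iT, (i+1)T)` -/
  um : ℕ → Input nu
  /-- plan applied at sampling index `i` -/
  plan : ℕ → Plan np nq nu
  /-- number `k` of the high-level update in force at sampling index `i` -/
  stage : ℕ → ℕ
  /-- horizon of the current problem at sampling index `i` -/
  Ncur : ℕ → ℕ
  /-- horizon of the contingency problem at sampling index `i` -/
  Nprev : ℕ → ℕ
  s : ℕ → S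
  b : ℕ → Z → ℝ
  a : ℕ → A
  /-- maximum likelihood estimate -/
  zhat : ℕ → Z
  /-- observable state whose cell is the goal cell -/
  snext : ℕ → S
  pgoal : ℕ → Pos np

namespace Run

variable {np nq nu : ℕ} {S Z A O : Type*}
  (P : Plant np nq nu) (H : HighLevel np S Z A O) (R : Run np nq nu S Z A)

/-- The execution is not stopped before the sampling time `iT`. -/
def Alive (i : ℕ) : Prop := ((i * P.T : ℝ) : EReal) ≤ R.θ

/-- The `k`-th high-level update takes place. -/
def Occurs (k : ℕ) : Prop := ∃ i, R.Alive P i ∧ R.stage i = k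

/-- Components of the planning problem set by the `k`-th high-level update. -/
def goalData (k : ℕ) : Goal np := ⟨H.cell (R.s k), H.cell (R.snext k), R.pgoal k⟩

/-- The current planning problem is feasible at `iT`. -/
def CurFeasible (i : ℕ) : Prop :=
  P.MPCFeasible i (R.Ncur i) (R.goalData H (R.stage i)) (R.x (i * P.T))

/-- There is a previous goal, and the contingency problem built on it is feasible at `iT`. -/
def PrevFeasible (i : ℕ) : Prop :=
  0 < R.stage i ∧
    P.MPCFeasible i (R.Nprev i) (R.goalData H (R.stage i - 1)) (R.x (i * P.T))

open Classical in
/-- Horizon of the current problem after the planning step at `iT`. -/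
def curNext (i : ℕ) : ℕ := if R.CurFeasible P H i then max 1 (R.Ncur i - 1) else R.Ncur i

open Classical in
/-- Horizon of the contingency problem after the planning step at `iT`. -/
def prevNext (i : ℕ) : ℕ := if R.CurFeasible P H i then R.Nprev i else max 1 (R.Nprev i - 1)

/-- At `iT` the position is in the goal cell of update `k`. -/
def InGoal (i k : ℕ) : Prop := pos (R.x (i * P.T)) ∈ H.cell (R.snext k)

/-- `R` is an execution of the augmented system in closed loop with the multi-rate algorithm from
the initial state `x₀`, when `obs k` is the observation received at the `k`-th high-level update.
It stops only at a time at which an optimization problem that has to be solved is infeasible. -/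
structure IsClosedLoop [Fintype Z] (x₀ : State np nq) (obs : ℕ → O) : Prop where
  θ_nonneg : 0 ≤ R.θ
  x_zero : R.x 0 = x₀
  -- initialization of the high level
  stage_zero : R.stage 0 = 0
  Ncur_zero : R.Ncur 0 = H.N
  s_zero : pos x₀ ∈ H.cell (R.s 0)
  b_zero : R.b 0 = fun z => (H.b₀ z).toReal
  -- the goal cell is reached: new high-level update
  update : ∀ i, R.Alive P (i + 1) → R.InGoal P H (i + 1) (R.stage i) →
    R.stage (i + 1) = R.stage i + 1 ∧
    pos (R.x ((i + 1 : ℕ) * P.T)) ∈ H.cell (R.s (R.stage i + 1)) ∧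
    R.b (R.stage i + 1) = H.M.beliefUpdate (R.s (R.stage i + 1)) (R.s (R.stage i))
      (obs (R.stage i + 1)) (R.a (R.stage i)) (R.b (R.stage i)) ∧
    R.Ncur (i + 1) = H.N ∧ R.Nprev (i + 1) = R.curNext P H i
  -- the goal cell is not reached: the goal is kept
  keep : ∀ i, R.Alive P (i + 1) → ¬ R.InGoal P H (i + 1) (R.stage i) →
    R.stage (i + 1) = R.stage i ∧
    R.Ncur (i + 1) = R.curNext P H i ∧ R.Nprev (i + 1) = R.prevNext P H i
  -- decisions of the high level at each update
  action : ∀ k, R.Occurs P k → R.a k = H.πh (R.s k) (R.b k)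
  estimate : ∀ k, R.Occurs P k → ∀ z, R.b k z ≤ R.b k (R.zhat k)
  goal : ∀ k, R.Occurs P k → R.snext k = H.M.fs (R.s k) (R.zhat k) (R.a k)
  -- the goal position is the projection of the forecasted cell center onto the goal cell
  goalPosition : ∀ k, R.Occurs P k → R.pgoal k ∈ closure (H.cell (R.snext k)) ∧
    ∀ d ∈ H.cell (R.snext k),
      dist (H.center (H.M.fs (R.snext k) (R.zhat k) (H.πh (R.snext k) (R.b k)))) (R.pgoal k) ≤
      dist (H.center (H.M.fs (R.snext k) (R.zhat k) (H.πh (R.snext k) (R.b k)))) d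
  -- planning step at the sampling times
  plan_cur : ∀ i, R.Alive P i → R.CurFeasible P H i →
    P.IsMPCSolution i (R.Ncur i) (R.goalData H (R.stage i)) (R.x (i * P.T)) (R.plan i)
  plan_prev : ∀ i, R.Alive P i → ¬ R.CurFeasible P H i → R.PrevFeasible P H i →
    P.IsMPCSolution i (R.Nprev i) (R.goalData H (R.stage i - 1)) (R.x (i * P.T)) (R.plan i)
  reset : ∀ i, R.Alive P i → (R.CurFeasible P H i ∨ R.PrevFeasible P H i) →
    R.xbar (i * P.T) = (R.plan i).x 0 ∧ R.um i = (R.plan i).v 0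
  -- reference trajectory between the sampling times
  xbar_cont : ∀ i : ℕ,
    ContinuousOn R.xbar {t | t ∈ Ico (i * P.T) ((i + 1) * P.T) ∧ (t : EReal) ≤ R.θ}
  xbar_deriv : ∀ i : ℕ, ∀ t ∈ Ioo (i * P.T) ((i + 1) * P.T), (t : EReal) < R.θ →
    HasDerivAt R.xbar (P.A i (R.xbar t) + P.B i (R.um i)) t
  -- low-level input
  low : ∀ i : ℕ, ∀ t ∈ Ico (i * P.T) ((i + 1) * P.T), (t : EReal) < R.θ →
    P.IsQPSolution i (R.x t) (R.xbar t) (R.um i) (R.ul t)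
  -- the nonlinear system, in the sense of Caratheodory
  dynamics : ∀ i : ℕ, ∀ t ∈ Icc (i * P.T) ((i + 1) * P.T), (t : EReal) ≤ R.θ →
    IntervalIntegrable (fun τ => P.f (R.x τ) + P.g (R.x τ) (R.ul τ + R.um i)) volume (i * P.T) t ∧
    R.x t = R.x (i * P.T) + ∫ τ in (i * P.T)..t, (P.f (R.x τ) + P.g (R.x τ) (R.ul τ + R.um i))
  -- the execution does not continue past an infeasible planning step
  continues : ∀ i : ℕ, ((i * P.T : ℝ) : EReal) < R.θ → R.CurFeasible P H i ∨ R.PrevFeasible P H i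
  -- and it stops only because of infeasibility
  stops : ∀ τ : ℝ, R.θ = τ →
    (∃ i : ℕ, τ = i * P.T ∧ ¬ R.CurFeasible P H i ∧ ¬ R.PrevFeasible P H i) ∨
    (∃ i : ℕ, τ ∈ Ico (i * P.T) ((i + 1) * P.T) ∧
      ¬ P.QPFeasible i (R.x τ) (R.xbar τ) (R.um i))

/-- Local reachability: from every state in `X_curr ⊕ E` the planning problem is feasible with the
full horizon, for each pair of current and goal cells issued during the execution. -/
def ReachabilityAssumption : Prop :=
  ∀ k, R.Occurs P k → ∀ (i : ℕ), ∀ ξ ∈ P.equilibria (H.cell (R.s k)) + P.E,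
    P.MPCFeasible i H.N (R.goalData H k) ξ

/-- Each goal cell is contained in the free space. -/
def FreeGoalAssumption (Xp : Set (Pos np)) : Prop :=
  ∀ k, R.Occurs P k → H.cell (R.snext k) ⊆ Xp

/-- While a contingency plan towards the previous goal is executed, the system does not happen to
be in the new goal cell at the next sampling time. -/
def NoEntryDuringContingency : Prop :=
  ∀ i, R.Alive P (i + 1) → ¬ R.CurFeasible P H i → ¬ R.InGoal P H (i + 1) (R.stage i)

end Run

/-- The environment `(z_k, o_k)` evolves according to the MOMDP: given the history up to update
`k`, the action `a_k` and the observable state `s_{k+1}` which the closed loop has reached at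
update `k+1`, the next environment state and observation have the laws `T_z` and `O`. -/
structure IsEnvironment {np nq nu : ℕ} {S Z A O Ω : Type*} [MeasurableSpace Ω]
    [MeasurableSpace Z] [MeasurableSpace O]
    (P : Plant np nq nu) (H : HighLevel np S Z A O) (o₀ : O) (μ : Measure Ω)
    (R : Ω → Run np nq nu S Z A) (z : ℕ → Ω → Z) (o : ℕ → Ω → O) : Prop where
  measurable_z : ∀ k, Measurable (z k)
  measurable_o : ∀ k, Measurable (o k)
  init_z : ∀ z₀, μ {ω | z 0 ω = z₀} = H.b₀ z₀
  init_o : ∀ ω, o 0 ω = o₀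
  step : ∀ (k : ℕ) (w : ℕ → S × Z × O) (a : A) (s' : S) (z' : Z) (o' : O),
    μ {ω | ((R ω).Occurs P (k + 1) ∧
        (∀ j ≤ k, (R ω).s j = (w j).1 ∧ z j ω = (w j).2.1 ∧ o j ω = (w j).2.2) ∧
        (R ω).a k = a ∧ (R ω).s (k + 1) = s') ∧ z (k + 1) ω = z' ∧ o (k + 1) ω = o'} =
      μ {ω | (R ω).Occurs P (k + 1) ∧
        (∀ j ≤ k, (R ω).s j = (w j).1 ∧ z j ω = (w j).2.1 ∧ o j ω = (w j).2.2) ∧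
        (R ω).a k = a ∧ (R ω).s (k + 1) = s'} *
      (H.M.Tz (w k).1 (w k).2.1 a s' z' * H.M.Obs s' z' a o')

end

end MultiRate

/-! Between sampling times the barrier constraint makes `h_e` increase along the tracking error
wherever `h_e < 0`, so an error that starts in `E` stays there (`barrier_nonneg`). The reference
ends the interval with left limit `Ābar x̄ + B̄bar u_m` in discretized form (`tendsto_linearODE`),
and `E` is closed. Hence the next measured state lies within `E` of the second planned state.

Recursive feasibility follows. The tail of a plan is feasible with horizon reduced by one. A plan
with horizon one ends in the goal cell, within `E` of an equilibrium there. If the goal cell is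
entered before the plan is finished, the new problem may be infeasible, but the old tail serves as
contingency plan. When that runs out, the state is within `E` of an equilibrium of the new current
cell, so reachability gives feasibility with the full horizon `N`. This horizon was kept untouched
meanwhile, and hypothesis (4) excludes another update. The number of remaining periods, `rank`,
drops until the goal is reached (`Run.Consistent.succ`). Since only infeasibility can stop an
execution, it never stops.

For the probabilistic part, disjointness of the cells gives `s_{k+1} = s_k^+`, which under the
likelihood hypothesis is the MOMDP successor. The actions are those of the belief policy, so the
cylinder probabilities of the closed loop obey the MOMDP recursion. They determine the law on
sequences (`map_eq_trajMeasure`), and optimality of `π_h` concludes. -/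

/-! ### Absolutely continuous trajectories and barrier functions -/

/-- A function whose increments are dominated by those of an absolutely continuous function is
absolutely continuous. -/
theorem AbsolutelyContinuousOnInterval.of_dist_le {X Y : Type*} [PseudoMetricSpace X]
    [PseudoMetricSpace Y] {f : ℝ → X} {g : ℝ → Y} {a b C : ℝ}
    (hg : AbsolutelyContinuousOnInterval g a b)
    (h : ∀ s ∈ uIcc a b, ∀ t ∈ uIcc a b, dist (f s) (f t) ≤ C * dist (g s) (g t)) :
    AbsolutelyContinuousOnInterval f a b := by
  unfold AbsolutelyContinuousOnInterval at hg ⊢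
  have hC := hg.const_mul C
  rw [mul_zero] at hC
  refine squeeze_zero' (Filter.Eventually.of_forall fun _ => Finset.sum_nonneg fun _ _ => dist_nonneg)
    ?_ hC
  refine Filter.eventually_inf_principal.2 (Filter.Eventually.of_forall fun I hI => ?_)
  rw [Finset.mul_sum]
  exact Finset.sum_le_sum fun i hi => h _ (hI.1 i hi).1 _ (hI.1 i hi).2

section Barrier

variable {E : Type*} [NormedAddCommGroup E] [NormedSpace ℝ E]

/-- The increments of `e` are integrals of `φ`, hence dominated by the increments of the primitive
of `‖φ‖`. -/
theorem absolutelyContinuousOnInterval_of_eq_integral {e φ : ℝ → E} {a b : ℝ} (hab : a ≤ b)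
    (hφ : IntervalIntegrable φ volume a b)
    (he : ∀ t ∈ Icc a b, e t = e a + ∫ τ in a..t, φ τ) :
    AbsolutelyContinuousOnInterval e a b := by
  have hint : ∀ s ∈ Icc a b, IntervalIntegrable φ volume a s := fun s hs =>
    hφ.mono_set (by rw [uIcc_of_le hab, uIcc_of_le hs.1]; exact Icc_subset_Icc_right hs.2)
  have hac := hφ.norm.absolutelyContinuousOnInterval_intervalIntegral (c := a) (by simp)
  refine hac.of_dist_le (C := 1) fun s hs t ht => ?_
  rw [uIcc_of_le hab] at hs ht
  rw [he s hs, he t ht, dist_add_left, one_mul, dist_eq_norm, Real.dist_eq,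
    intervalIntegral.integral_interval_sub_left (hint s hs) (hint t ht),
    intervalIntegral.integral_interval_sub_left (hint s hs).norm (hint t ht).norm]
  exact intervalIntegral.norm_integral_le_abs_integral_norm

/-- A barrier function which does not decrease along a trajectory while it is negative stays
nonnegative. -/
theorem barrier_nonneg [FiniteDimensional ℝ E] {h : E → ℝ} (hh : ContDiff ℝ 1 h)
    {e φ : ℝ → E} {a b : ℝ} (hab : a ≤ b) (hφ : IntervalIntegrable φ volume a b)
    (he : ∀ t ∈ Icc a b, e t = e a + ∫ τ in a..t, φ τ) (ha : 0 ≤ h (e a))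
    (hd : ∀ t ∈ Ioo a b, h (e t) < 0 → 0 ≤ fderiv ℝ h (e t) (φ t)) :
    0 ≤ h (e b) := by
  by_contra! hb
  have hac := absolutelyContinuousOnInterval_of_eq_integral hab hφ he
  have hcont : ContinuousOn e (Icc a b) := by simpa [uIcc_of_le hab] using hac.continuousOn
  have hhc : ContinuousOn (fun t => h (e t)) (Icc a b) := hh.continuous.comp_continuousOn hcont
  set S := Icc a b ∩ (fun t => h (e t)) ⁻¹' Ici 0 with hS
  have hScl : IsCompact S :=
    isCompact_Icc.of_isClosed_subset (hhc.preimage_isClosed_of_isClosed isClosed_Icc isClosed_Ici)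
      inter_subset_left
  have hSne : S.Nonempty := ⟨a, ⟨left_mem_Icc.2 hab, ha⟩⟩
  -- `c` is the last time at which `h ∘ e` is nonnegative; on `(c, b)` it is negative and `hd`
  -- applies.
  obtain ⟨c, hcS, hcmax⟩ := hScl.exists_isGreatest hSne
  have hcb : c ≤ b := hcS.1.2
  have hac0 : a ≤ c := hcS.1.1
  have hneg : ∀ t ∈ Ioo c b, h (e t) < 0 := fun t ht => by
    by_contra! hcon
    exact absurd (hcmax ⟨⟨hac0.trans ht.1.le, ht.2.le⟩, hcon⟩) (not_le.2 ht.1)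
  obtain ⟨r, hr⟩ := (isCompact_Icc.image_of_continuousOn hcont).isBounded.subset_closedBall 0
  -- A `C¹` function is Lipschitz on a ball containing the compact trajectory. So `h ∘ e` is
  -- absolutely continuous, and its increment is the integral of a derivative that is only known
  -- almost everywhere.
  obtain ⟨K, hK⟩ := hh.contDiffOn.exists_lipschitzOnWith (s := Metric.closedBall (0 : E) r)
    (by decide) (convex_closedBall _ _) (isCompact_closedBall _ _)
  have hmem : ∀ t ∈ Icc a b, e t ∈ Metric.closedBall (0 : E) r := fun t ht =>
    hr (mem_image_of_mem e ht)
  have hhac : AbsolutelyContinuousOnInterval (fun t => h (e t)) a b := by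
    refine hac.of_dist_le (C := K) fun s hs t ht => ?_
    rw [uIcc_of_le hab] at hs ht
    exact hK.dist_le_mul _ (hmem s hs) _ (hmem t ht)
  have hsub : uIcc c b ⊆ uIcc a b := by
    rw [uIcc_of_le hab, uIcc_of_le hcb]; exact Icc_subset_Icc_left hac0
  have hftc := (hhac.mono hsub).integral_deriv_eq_sub
  have hnn : 0 ≤ ∫ t in c..b, deriv (fun t => h (e t)) t := by
    rw [intervalIntegral.integral_of_le hcb, integral_Ioc_eq_integral_Ioo]
    refine setIntegral_nonneg_of_ae_restrict ?_
    filter_upwards [ae_restrict_of_ae hφ.ae_hasDerivAt_integral,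
      ae_restrict_mem measurableSet_Ioo] with t ht htm
    have htab : t ∈ Ioo a b := ⟨hac0.trans_lt htm.1, htm.2⟩
    have h1 := (ht (by rw [uIcc_of_le hab]; exact Ioo_subset_Icc_self htab) a (by simp)).const_add
      (e a)
    have h2 : HasDerivAt e (φ t) t := h1.congr_of_eventuallyEq <| by
      filter_upwards [Ioo_mem_nhds htab.1 htab.2] with s hs
      exact he s (Ioo_subset_Icc_self hs)
    have h3 : HasDerivAt (fun t => h (e t)) (fderiv ℝ h (e t) (φ t)) t :=
      ((hh.differentiable (by decide)) (e t)).hasFDerivAt.comp_hasDerivAt t h2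
    rw [Pi.zero_apply, h3.deriv]
    exact hd t htab (hneg t htm)
  have : (0 : ℝ) ≤ h (e c) := hcS.2
  linarith

end Barrier

/-! ### Variation of constants for the reference model -/

section LinearODE

variable {E : Type*} [NormedAddCommGroup E] [NormedSpace ℝ E] [CompleteSpace E]

/-- The left limit of a solution of `y' = A y + b` at the end of the interval `[a, a + T)`. -/
theorem tendsto_linearODE {A : E →L[ℝ] E} {b : E} {y : ℝ → E} {a T : ℝ} (hT : 0 < T)
    (hc : ContinuousOn y (Ico a (a + T)))
    (hd : ∀ t ∈ Ioo a (a + T), HasDerivAt y (A (y t) + b) t) :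
    Filter.Tendsto y (nhdsWithin (a + T) (Iio (a + T)))
      (nhds ((NormedSpace.exp (T • A) : E →L[ℝ] E) (y a) +
        ∫ η in (0 : ℝ)..T, (NormedSpace.exp ((T - η) • A) : E →L[ℝ] E) b)) := by
  let Φ : ℝ → E →L[ℝ] E := fun s => NormedSpace.exp (s • A)
  have hΦd : ∀ s, HasDerivAt Φ (Φ s * A) s := fun s => hasDerivAt_exp_smul_const A s
  have hΦc : Continuous Φ := continuous_iff_continuousAt.2 fun s => (hΦd s).continuousAt
  have hΦinv : ∀ s, Φ (-s) * Φ s = 1 := fun s => by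
    have h : Commute ((-s) • A) (s • A) := ((Commute.refl A).smul_left _).smul_right _
    let _ : NormedAlgebra ℚ (E →L[ℝ] E) := NormedAlgebra.restrictScalars ℚ ℝ _
    have := NormedSpace.exp_add_of_commute h
    simp only [Φ]
    rw [← this, ← add_smul]
    simp
  -- Integrating factor: the two terms with `A` cancel in the derivative of `w`, leaving `Φ (a + T -
  -- t) b`.
  let w : ℝ → E := fun t => Φ (a + T - t) (y t)
  have hgc : Continuous fun t => Φ (a + T - t) b := by fun_prop
  have hw : ∀ t ∈ Ico a (a + T), w t = Φ T (y a) + ∫ r in a..t, Φ (a + T - r) b := by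
    intro t ht
    have hderiv : ∀ r ∈ Ioo a t, HasDerivAt w (Φ (a + T - r) b) r := fun r hr => by
      have h1 : HasDerivAt (fun r => Φ (a + T - r)) (-(Φ (a + T - r) * A)) r := by
        have := (hΦd (a + T - r)).scomp r ((hasDerivAt_id' r).const_sub (a + T))
        rwa [neg_smul, one_smul] at this
      have h2 := h1.clm_apply (hd r ⟨hr.1, hr.2.trans ht.2⟩)
      convert h2 using 1
      simp
    have hwc : ContinuousOn w (Icc a t) := by
      have h1 : ContinuousOn (fun r => Φ (a + T - r)) (Icc a t) :=
        (hΦc.comp (by fun_prop)).continuousOn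
      exact h1.clm_apply (hc.mono (Icc_subset_Ico_right ht.2))
    have := intervalIntegral.integral_eq_sub_of_hasDerivAt_of_le ht.1 hwc hderiv
      (hgc.intervalIntegrable _ _)
    rw [this]
    simp [w]
  -- Undoing the factor expresses `y` on the half-open interval by a formula continuous on all of
  -- `ℝ`; its value at `a + T` is the left limit.
  have hy : ∀ t ∈ Ico a (a + T),
      y t = Φ (-(a + T - t)) (Φ T (y a) + ∫ r in a..t, Φ (a + T - r) b) := fun t ht => by
    rw [← hw t ht]
    have := congrArg (fun L : E →L[ℝ] E => L (y t)) (hΦinv (a + T - t))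
    simpa [w] using this.symm
  have hlim : Filter.Tendsto
      (fun t => Φ (-(a + T - t)) (Φ T (y a) + ∫ r in a..t, Φ (a + T - r) b))
      (nhds (a + T)) (nhds (Φ T (y a) + ∫ η in (0 : ℝ)..T, Φ (T - η) b)) := by
    have hcont : Continuous
        (fun t => Φ (-(a + T - t)) (Φ T (y a) + ∫ r in a..t, Φ (a + T - r) b)) := by
      have h1 : Continuous fun t => Φ (-(a + T - t)) := hΦc.comp (by fun_prop)
      exact h1.clm_apply (continuous_const.add
        (intervalIntegral.continuous_primitive (fun _ _ => hgc.intervalIntegrable _ _) a))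
    have h0 : Φ 0 = 1 := by simp [Φ]
    have hsub : ∫ r in a..(a + T), Φ (a + T - r) b = ∫ η in (0 : ℝ)..T, Φ (T - η) b := by
      have := intervalIntegral.integral_comp_add_left (a := 0) (b := T)
        (fun r => Φ (a + T - r) b) a
      rw [add_zero] at this
      rw [← this]
      simp only [add_sub_add_left_eq_sub]
    have := hcont.tendsto (a + T)
    simp only [sub_self, neg_zero, h0, hsub] at this
    simpa using this
  refine (hlim.mono_left nhdsWithin_le_nhds).congr' ?_
  filter_upwards [Ico_mem_nhdsLT (show a < a + T by linarith)] with t ht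
  exact (hy t ht).symm

end LinearODE

namespace MultiRate

/-! ### Tracking over one sampling interval -/

theorem Plant.zero_mem_E {np nq nu : ℕ} (P : Plant np nq nu) : (0 : State np nq) ∈ P.E := P.he_zero

theorem Plant.isClosed_E {np nq nu : ℕ} (P : Plant np nq nu) : IsClosed P.E :=
  isClosed_le continuous_const P.he_smooth.continuous

theorem Plant.Bbar_apply {np nq nu : ℕ} (P : Plant np nq nu) (i : ℕ) (u : Input nu) :
    P.Bbar i u = ∫ η in (0 : ℝ)..P.T,
      (NormedSpace.exp ((P.T - η) • P.A i) : State np nq →L[ℝ] State np nq) (P.B i u) := by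
  have hc : Continuous fun η : ℝ =>
      (NormedSpace.exp ((P.T - η) • P.A i) : State np nq →L[ℝ] State np nq) :=
    (differentiable_exp_smul_const ℝ (P.A i)).continuous.comp (continuous_const.sub continuous_id)
  unfold Plant.Bbar
  rw [ContinuousLinearMap.intervalIntegral_apply
    ((hc.clm_comp continuous_const).intervalIntegrable _ _)]
  rfl

namespace Run

variable {np nq nu : ℕ} {S Z A O : Type*} [Fintype Z]
  {P : Plant np nq nu} {H : HighLevel np S Z A O} {R : Run np nq nu S Z A}
  {x₀ : State np nq} {obs : ℕ → O}

/-- The tracking error stays in the safe set between the sampling times. -/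
theorem IsClosedLoop.error_mem (hR : R.IsClosedLoop P H x₀ obs) {i : ℕ}
    (h₀ : R.x (i * P.T) - R.xbar (i * P.T) ∈ P.E) {τ : ℝ}
    (hτ : τ ∈ Ico (i * P.T) ((i + 1) * P.T)) (hθ : (τ : EReal) ≤ R.θ) :
    R.x τ - R.xbar τ ∈ P.E := by
  have hle : ∀ t ≤ τ, (t : EReal) ≤ R.θ := fun t ht => (EReal.coe_le_coe_iff.2 ht).trans hθ
  have hlt : ∀ t < τ, (t : EReal) < R.θ := fun t ht => (EReal.coe_lt_coe_iff.2 ht).trans_le hθ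
  have hbc : ContinuousOn R.xbar (Icc (i * P.T) τ) := (hR.xbar_cont i).mono fun t ht =>
    ⟨⟨ht.1, ht.2.trans_lt hτ.2⟩, hle t ht.2⟩
  have hvc : ContinuousOn (fun t => P.A i (R.xbar t) + P.B i (R.um i)) (Icc (i * P.T) τ) :=
    ((P.A i).continuous.comp_continuousOn hbc).add continuousOn_const
  have hvi : ∀ t ∈ Icc (i * P.T) τ, IntervalIntegrable
      (fun t => P.A i (R.xbar t) + P.B i (R.um i)) volume (i * P.T) t := fun t ht =>
    (hvc.mono (Icc_subset_Icc_right ht.2)).intervalIntegrable_of_Icc ht.1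
  have hb : ∀ t ∈ Icc (i * P.T) τ, ∫ r in (i * P.T)..t, (P.A i (R.xbar r) + P.B i (R.um i)) =
      R.xbar t - R.xbar (i * P.T) := fun t ht =>
    intervalIntegral.integral_eq_sub_of_hasDerivAt_of_le ht.1
      (hbc.mono (Icc_subset_Icc_right ht.2))
      (fun r hr => hR.xbar_deriv i r ⟨hr.1, (hr.2.trans_le ht.2).trans hτ.2⟩
        (hlt r (hr.2.trans_le ht.2))) (hvi t ht)
  have hx : ∀ t ∈ Icc (i * P.T) τ, _ := fun t ht =>
    hR.dynamics i t ⟨ht.1, ht.2.trans hτ.2.le⟩ (hle t ht.2)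
  have hmem : τ ∈ Icc (i * P.T) τ := right_mem_Icc.2 hτ.1
  refine barrier_nonneg P.he_smooth (e := fun t => R.x t - R.xbar t)
    (φ := fun t => P.errorField i (R.x t) (R.xbar t) (R.ul t) (R.um i)) hτ.1
    ((hx τ hmem).1.sub (hvi τ hmem)) (fun t ht => ?_) h₀ fun t ht hneg => ?_
  · unfold Plant.errorField
    rw [intervalIntegral.integral_sub (hx t ht).1 (hvi t ht), hb t ht, (hx t ht).2]
    abel
  -- The barrier constraint also holds outside `E`: if `h_e < 0`, then `-α (h_e) > 0`, so the
  -- derivative is positive.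
  · obtain ⟨γ, hγ, -⟩ := hR.low i t ⟨ht.1.le, ht.2.trans hτ.2⟩ (hlt t ht.2)
    have h1 := hγ.2.2
    have h2 := P.α_strictMono hneg
    rw [P.α_zero] at h2
    linarith

/-- At the next sampling time the state is in the safe set around the predicted state. -/
theorem IsClosedLoop.error_mem_next (hR : R.IsClosedLoop P H x₀ obs) {i : ℕ}
    (h₀ : R.x (i * P.T) - R.xbar (i * P.T) ∈ P.E) (hi : R.Alive P (i + 1)) :
    R.x ((i + 1 : ℕ) * P.T) - (P.Abar i (R.xbar (i * P.T)) + P.Bbar i (R.um i)) ∈ P.E := by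
  have hT := P.T_pos
  unfold Alive at hi
  have hend : ((i : ℝ) + 1) * P.T = i * P.T + P.T := by ring
  have hlt : (i : ℝ) * P.T < (i + 1) * P.T := by linarith
  push_cast at hi ⊢
  have hle : ∀ t ≤ ((i : ℝ) + 1) * P.T, (t : EReal) ≤ R.θ := fun t ht =>
    (EReal.coe_le_coe_iff.2 ht).trans hi
  have hlt' : ∀ t < ((i : ℝ) + 1) * P.T, (t : EReal) < R.θ := fun t ht =>
    (EReal.coe_lt_coe_iff.2 ht).trans_le hi
  -- At `(i+1)T` itself `xbar` may be reset, so the prediction is available only as a left limit.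
  have hbar : Filter.Tendsto R.xbar (nhdsWithin ((i + 1) * P.T) (Iio ((i + 1) * P.T)))
      (nhds (P.Abar i (R.xbar (i * P.T)) + P.Bbar i (R.um i))) := by
    rw [P.Bbar_apply, hend]
    refine tendsto_linearODE hT ?_ fun t ht => ?_
    · exact (hR.xbar_cont i).mono fun t ht => by
        rw [← hend] at ht; exact ⟨ht, hle t ht.2.le⟩
    · rw [← hend] at ht; exact hR.xbar_deriv i t ht (hlt' t ht.2)
  have hxc : ContinuousOn R.x (Icc (i * P.T) ((i + 1) * P.T)) := by
    have := (absolutelyContinuousOnInterval_of_eq_integral hlt.le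
      (hR.dynamics i _ (right_mem_Icc.2 hlt.le) (hle _ le_rfl)).1
      fun t ht => (hR.dynamics i t ht (hle t ht.2)).2).continuousOn
    rwa [uIcc_of_le hlt.le] at this
  have hx : Filter.Tendsto R.x (nhdsWithin ((i + 1) * P.T) (Iio ((i + 1) * P.T)))
      (nhds (R.x ((i + 1) * P.T))) := by
    have h1 : ContinuousWithinAt R.x (Ico (i * P.T) ((i + 1) * P.T)) ((i + 1) * P.T) :=
      (hxc _ (right_mem_Icc.2 hlt.le)).mono Ico_subset_Icc_self
    rw [ContinuousWithinAt, nhdsWithin_Ico_eq_nhdsLT hlt] at h1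
    exact h1
  refine P.isClosed_E.mem_of_tendsto (hx.sub hbar) ?_
  filter_upwards [Ico_mem_nhdsLT hlt] with t ht
  exact hR.error_mem h₀ ht (hle t ht.2.le)

/-- An execution with a safe tracking error and an admissible mid-level input at `iT`, where a
planning problem is feasible, does not stop before `(i+1)T`. -/
theorem IsClosedLoop.alive_succ (hR : R.IsClosedLoop P H x₀ obs)
    (hQP : P.QPFeasibilityAssumption) {i : ℕ} (hi : R.Alive P i)
    (hfeas : R.CurFeasible P H i ∨ R.PrevFeasible P H i)
    (h₀ : R.x (i * P.T) - R.xbar (i * P.T) ∈ P.E) (hu : R.um i ∈ P.Um) :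
    R.Alive P (i + 1) := by
  have hT := P.T_pos
  by_contra hn
  unfold Alive at hi hn
  rw [not_le] at hn
  -- Sampling intervals are disjoint, so the index supplied by `stops` must be `i`.
  have hidx : ∀ (j : ℕ) (t : ℝ), t ∈ Ico (j * P.T) ((j + 1) * P.T) →
      t ∈ Ico (i * P.T) ((i + 1) * P.T) → j = i := fun j t hj hi => by
    have h1 : (j : ℝ) < i + 1 := lt_of_mul_lt_mul_right (hj.1.trans_lt hi.2) hT.le
    have h2 : (i : ℝ) < j + 1 := lt_of_mul_lt_mul_right (hi.1.trans_lt hj.2) hT.le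
    norm_cast at h1 h2
    omega
  obtain ⟨τ, hτ⟩ : ∃ τ : ℝ, R.θ = τ := by
    refine ⟨R.θ.toReal, (EReal.coe_toReal hn.ne_top ?_).symm⟩
    rintro h
    rw [h, le_bot_iff] at hi
    exact EReal.coe_ne_bot _ hi
  rw [hτ, EReal.coe_le_coe_iff] at hi
  rw [hτ, EReal.coe_lt_coe_iff] at hn
  push_cast at hn
  rcases hR.stops τ hτ with ⟨j, hj, h1, h2⟩ | ⟨j, hj, h1⟩
  · obtain rfl := hidx j τ ⟨hj.ge, by rw [hj]; nlinarith⟩ ⟨hi, hn⟩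
    exact hfeas.elim h1 h2
  · obtain rfl := hidx j τ hj ⟨hi, hn⟩
    exact h1 (hQP j _ _ (hR.error_mem h₀ hj hτ.ge) _ hu)

end Run

/-! ### Recursive feasibility -/

namespace Plant

variable {np nq nu : ℕ} {P : Plant np nq nu} {i n : ℕ} {c : Goal np} {x y : State np nq}
  {p : Plan np nq nu}

/-- The tightening by `E` at `t = 0` absorbs the initial error, so the measured state itself meets
the untightened constraints. This is the source of safety at the sampling times. -/
theorem MPCConstraints.mem_Xpq (h : P.MPCConstraints i n c x p) (hn : 1 ≤ n) : x ∈ P.Xpq c := by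
  simpa using (h.2.1 0 hn).1 _ h.2.2.1

/-- The tail of an admissible plan is admissible at the next sampling time. -/
theorem MPCConstraints.tail_feasible (h : P.MPCConstraints i n c x p) (hn : 2 ≤ n)
    (hy : y - p.x 1 ∈ P.E) : P.MPCFeasible (i + 1) (n - 1) c y := by
  obtain ⟨h1, h2, -, h4⟩ := h
  refine ⟨⟨fun t => p.x (t + 1), fun t => p.v (t + 1)⟩, fun t ht => ?_, fun t ht => ?_, hy, ?_⟩
  · have := h1 (t + 1) (by omega)
    rw [show i + 1 + t = i + (t + 1) by ring]
    exact this
  · exact h2 (t + 1) (by omega)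
  · change p.x (n - 1 + 1) ∈ _
    rwa [Nat.sub_add_cancel (by omega)]

/-- A plan with horizon one brings the system into the goal cell. -/
theorem MPCConstraints.terminal (h : P.MPCConstraints i 1 c x p) (hy : y - p.x 1 ∈ P.E) :
    pos y ∈ c.goal ∧ y ∈ P.equilibria c.goal + P.E := by
  have h4 := h.2.2.2
  constructor
  -- Only the position error matters here: deleting its `q` part gives an element of `E_p` and
  -- leaves the position of `p.x 1 + e` equal to that of `y`.
  · let e : State np nq := WithLp.toLp 2 (Sum.elim (fun j => (y - p.x 1) (Sum.inl j)) 0)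
    have he : e ∈ P.Ep := ⟨y - p.x 1, hy, by ext j; simp [e, pos], by ext j; simp [e, rest]⟩
    have h5 := (h4 e he).1
    have h6 : pos (p.x 1 + e) = pos y := by ext j; simp [e, pos]
    rwa [h6] at h5
  -- Since `0 ∈ E_p`, the terminal planned state is itself an equilibrium over the goal cell.
  · have h0 : (0 : State np nq) ∈ P.Ep := ⟨0, P.zero_mem_E, rfl, by ext j; simp [rest]⟩
    have h5 := h4 0 h0
    rw [add_zero] at h5
    exact ⟨p.x 1, h5, y - p.x 1, hy, by simp⟩

end Plant

theorem HighLevel.eq_of_mem_cell {np : ℕ} {S Z A O : Type*} (H : HighLevel np S Z A O) {q : Pos np} {s s' : S} (h : q ∈ H.cell s)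
    (h' : q ∈ H.cell s') : s = s' := by
  by_contra hne
  exact (Set.disjoint_left.1 (H.cell_disjoint hne)) h h'

theorem Run.θ_eq_top {np nq nu : ℕ} {S Z A : Type*} {P : Plant np nq nu}
    {R : Run np nq nu S Z A} (h : ∀ i, R.Alive P i) :
    R.θ = ⊤ := by
  refine EReal.eq_top_iff_forall_lt _ |>.2 fun y => ?_
  obtain ⟨n, hn⟩ := exists_nat_gt (y / P.T)
  rw [div_lt_iff₀ P.T_pos] at hn
  exact lt_of_lt_of_le (EReal.coe_lt_coe_iff.2 hn) (h n)

namespace Run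

variable {np nq nu : ℕ} {S Z A O : Type*} [Fintype Z]
  {P : Plant np nq nu} {H : HighLevel np S Z A O} {R : Run np nq nu S Z A}
  {x₀ : State np nq} {obs : ℕ → O}

/-- The problem solved at `iT` when the execution goes on, with its consequences for the interval
up to the next sampling time. -/
structure Executes (P : Plant np nq nu) (R : Run np nq nu S Z A) (i n : ℕ) (c : Goal np) :
    Prop where
  constraints : P.MPCConstraints i n c (R.x (i * P.T)) (R.plan i)
  alive : R.Alive P (i + 1)
  next : R.x ((i + 1 : ℕ) * P.T) - (R.plan i).x 1 ∈ P.E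
  input : ∀ t ∈ Ico (i * P.T) ((i + 1) * P.T), R.ul t + R.um i ∈ P.U

/-- The reset makes the first planned state the reference, so the plan's constraints provide both
the safe initial error and the admissible input on which the one-interval tracking results rest.
Their prediction is then the second planned state. -/
theorem IsClosedLoop.executes (hR : R.IsClosedLoop P H x₀ obs)
    (hQP : P.QPFeasibilityAssumption) {i n : ℕ} {c : Goal np} (hn : 1 ≤ n) (hi : R.Alive P i)
    (hfeas : R.CurFeasible P H i ∨ R.PrevFeasible P H i)
    (hplan : P.MPCConstraints i n c (R.x (i * P.T)) (R.plan i)) : Executes P R i n c := by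
  obtain ⟨hx, hu⟩ := hR.reset i hi hfeas
  have h₀ : R.x (i * P.T) - R.xbar (i * P.T) ∈ P.E := by rw [hx]; exact hplan.2.2.1
  have hum : R.um i ∈ P.Um := by rw [hu]; exact (hplan.2.1 0 hn).2
  have hal := hR.alive_succ hQP hi hfeas h₀ hum
  refine ⟨hplan, hal, ?_, fun t ht => ?_⟩
  · have := hR.error_mem_next h₀ hal
    rw [hx, hu] at this
    rwa [show (1 : ℕ) = 0 + 1 from rfl, hplan.1 0 hn]
  · have hlt : (t : EReal) < R.θ := by
      refine lt_of_lt_of_le (EReal.coe_lt_coe_iff.2 ht.2) ?_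
      have := hal
      unfold Alive at this
      exact_mod_cast this
    obtain ⟨γ, hγ, -⟩ := hR.low i t ht hlt
    exact Set.add_mem_add hγ.1 hum

/-- The induction hypothesis of recursive feasibility at the sampling time `iT`. -/
structure Consistent (P : Plant np nq nu) (H : HighLevel np S Z A O) (R : Run np nq nu S Z A)
    (i : ℕ) : Prop where
  alive : R.Alive P i
  one_le : 1 ≤ R.Ncur i
  feasible : R.CurFeasible P H i ∨
    (R.PrevFeasible P H i ∧ R.Ncur i = H.N ∧ 1 ≤ R.Nprev i)
  occurs : ∀ k ≤ R.stage i, R.Occurs P k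
  chain : ∀ k < R.stage i, R.s (k + 1) = R.snext k

open Classical in
/-- An upper bound for the number of sampling periods until the current goal is reached. -/
noncomputable def rank (P : Plant np nq nu) (H : HighLevel np S Z A O) (R : Run np nq nu S Z A)
    (i : ℕ) : ℕ := if R.CurFeasible P H i then R.Ncur i else H.N + R.Nprev i

theorem IsClosedLoop.s_zero_eq (hR : R.IsClosedLoop P H x₀ obs) {s₀ : S}
    (hs₀ : pos x₀ ∈ H.cell s₀) : R.s 0 = s₀ :=
  H.eq_of_mem_cell hR.s_zero hs₀

theorem IsClosedLoop.consistent_zero (hR : R.IsClosedLoop P H x₀ obs) {s₀ : S}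
    (hs₀ : pos x₀ ∈ H.cell s₀) (hx₀ : x₀ ∈ P.equilibria (H.cell s₀) + P.E)
    (hReach : R.ReachabilityAssumption P H) : Consistent P H R 0 := by
  have hal : R.Alive P 0 := by simpa [Alive] using hR.θ_nonneg
  have hocc : R.Occurs P 0 := ⟨0, hal, hR.stage_zero⟩
  refine ⟨hal, hR.Ncur_zero ▸ H.N_pos, Or.inl ?_, fun k hk => ?_, fun k hk => ?_⟩
  · unfold CurFeasible
    rw [hR.Ncur_zero, hR.stage_zero]
    refine hReach 0 hocc 0 _ ?_
    rw [hR.s_zero_eq hs₀]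
    simpa [hR.x_zero] using hx₀
  · rw [hR.stage_zero, Nat.le_zero] at hk
    exact hk ▸ hocc
  · rw [hR.stage_zero] at hk
    omega

/-- The problem executed at `iT` is the current one or the contingency problem. -/
theorem Consistent.executes {i : ℕ} (hC : Consistent P H R i) (hR : R.IsClosedLoop P H x₀ obs)
    (hQP : P.QPFeasibilityAssumption) :
    (R.CurFeasible P H i ∧ Executes P R i (R.Ncur i) (R.goalData H (R.stage i))) ∨
    (¬ R.CurFeasible P H i ∧ R.PrevFeasible P H i ∧ R.Ncur i = H.N ∧ 1 ≤ R.Nprev i ∧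
      Executes P R i (R.Nprev i) (R.goalData H (R.stage i - 1))) := by
  by_cases hcur : R.CurFeasible P H i
  · exact Or.inl ⟨hcur, hR.executes hQP hC.one_le hC.alive (Or.inl hcur)
      (hR.plan_cur i hC.alive hcur).1⟩
  · obtain ⟨hprev, hN, hone⟩ := hC.feasible.resolve_left hcur
    exact Or.inr ⟨hcur, hprev, hN, hone, hR.executes hQP hone hC.alive (Or.inr hprev)
      (hR.plan_prev i hC.alive hcur hprev).1⟩

/-- The invariant records `Ncur = N` under contingency because reachability guarantees feasibility
only with the full horizon. This also explains the value `N + Nprev` of `rank`: the contingency plan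
lasts at most `Nprev` periods, after which the current problem takes over with horizon `N`. -/
theorem Consistent.succ {i : ℕ} (hC : Consistent P H R i) (hR : R.IsClosedLoop P H x₀ obs)
    (hQP : P.QPFeasibilityAssumption) (hReach : R.ReachabilityAssumption P H)
    (hEntry : R.NoEntryDuringContingency P H) :
    Consistent P H R (i + 1) ∧
      ((R.InGoal P H (i + 1) (R.stage i) ∧ R.stage (i + 1) = R.stage i + 1) ∨
        (R.stage (i + 1) = R.stage i ∧ rank P H R (i + 1) < rank P H R i)) := by
  have hNpos := H.N_pos
  rcases hC.executes hR hQP with ⟨hcur, hX⟩ | ⟨hcur, hprev, hN, hone, hX⟩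
  · have hone := hC.one_le
    by_cases hgoal : R.InGoal P H (i + 1) (R.stage i)
    · obtain ⟨hst, hcell, -, hNc, hNp⟩ := hR.update i hX.alive hgoal
      have hs : R.s (R.stage i + 1) = R.snext (R.stage i) := H.eq_of_mem_cell hcell hgoal
      have hocc : R.Occurs P (R.stage i + 1) := ⟨i + 1, hX.alive, hst⟩
      have hNp' : R.Nprev (i + 1) = max 1 (R.Ncur i - 1) := by
        rw [hNp]; unfold curNext; rw [if_pos hcur]
      refine ⟨⟨hX.alive, by omega, ?_, fun k hk => ?_, fun k hk => ?_⟩, Or.inl ⟨hgoal, hst⟩⟩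
      -- With horizon one the old plan is finished and reachability applies to the new problem;
      -- otherwise its tail is the contingency plan.
      · rcases Nat.lt_or_ge (R.Ncur i) 2 with h2 | h2
        · refine Or.inl ?_
          have h1 : R.Ncur i = 1 := by omega
          have hc := hX.constraints
          rw [h1] at hc
          unfold CurFeasible
          rw [hNc, hst]
          refine hReach _ hocc _ _ ?_
          rw [hs]
          exact (hc.terminal hX.next).2
        · refine Or.inr ⟨⟨by omega, ?_⟩, hNc, by omega⟩
          rw [hst, hNp', Nat.add_sub_cancel, max_eq_right (by omega)]
          exact hX.constraints.tail_feasible h2 hX.next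
      · rw [hst] at hk
        rcases Nat.lt_or_ge (R.stage i) k with h | h
        · obtain rfl : k = R.stage i + 1 := by omega
          exact hocc
        · exact hC.occurs k h
      · rw [hst] at hk
        rcases Nat.lt_or_ge k (R.stage i) with h | h
        · exact hC.chain k h
        · obtain rfl : k = R.stage i := by omega
          exact hs
    · obtain ⟨hst, hNc, -⟩ := hR.keep i hX.alive hgoal
      unfold curNext at hNc
      rw [if_pos hcur] at hNc
      -- A plan with horizon one would have reached the goal, so the truncation at `1` is inactive.
      have h2 : 2 ≤ R.Ncur i := by
        by_contra h2
        have h1 : R.Ncur i = 1 := by omega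
        have hc := hX.constraints
        rw [h1] at hc
        exact hgoal (hc.terminal hX.next).1
      rw [max_eq_right (by omega)] at hNc
      have hcur' : R.CurFeasible P H (i + 1) := by
        unfold CurFeasible
        rw [hst, hNc]
        exact hX.constraints.tail_feasible h2 hX.next
      refine ⟨⟨hX.alive, by omega, Or.inl hcur', hst ▸ hC.occurs, hst ▸ hC.chain⟩,
        Or.inr ⟨hst, ?_⟩⟩
      unfold rank
      rw [if_pos hcur, if_pos hcur']
      omega
  · obtain ⟨hst, hNc, hNp⟩ := hR.keep i hX.alive (hEntry i hX.alive hcur)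
    unfold curNext at hNc
    unfold prevNext at hNp
    rw [if_neg hcur] at hNc hNp
    have hpos := hprev.1
    have hfeas : R.CurFeasible P H (i + 1) ∨ (2 ≤ R.Nprev i ∧ R.PrevFeasible P H (i + 1)) := by
      rcases Nat.lt_or_ge (R.Nprev i) 2 with h2 | h2
      · refine Or.inl ?_
        have h1 : R.Nprev i = 1 := by omega
        have hc := hX.constraints
        rw [h1] at hc
        unfold CurFeasible
        rw [hst, hNc, hN]
        refine hReach _ (hC.occurs _ le_rfl) _ _ ?_
        -- The contingency plan ends in the goal cell of the previous update, which is the current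
        -- cell of the present one.
        have hs := hC.chain (R.stage i - 1) (by omega)
        rw [Nat.sub_add_cancel hpos] at hs
        rw [hs]
        exact (hc.terminal hX.next).2
      · refine Or.inr ⟨h2, hst ▸ hpos, ?_⟩
        rw [hst, hNp, max_eq_right (by omega)]
        exact hX.constraints.tail_feasible h2 hX.next
    refine ⟨⟨hX.alive, by omega, hfeas.imp_right fun h => ⟨h.2, by omega, by omega⟩,
      hst ▸ hC.occurs, hst ▸ hC.chain⟩, Or.inr ⟨hst, ?_⟩⟩
    unfold rank
    rw [if_neg hcur]
    split_ifs with h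
    · omega
    · have := (hfeas.resolve_left h).1
      omega

variable {s₀ : S}

theorem IsClosedLoop.consistent (hR : R.IsClosedLoop P H x₀ obs)
    (hs₀ : pos x₀ ∈ H.cell s₀) (hx₀ : x₀ ∈ P.equilibria (H.cell s₀) + P.E)
    (hQP : P.QPFeasibilityAssumption) (hReach : R.ReachabilityAssumption P H)
    (hEntry : R.NoEntryDuringContingency P H) (i : ℕ) : Consistent P H R i := by
  induction i with
  | zero => exact hR.consistent_zero hs₀ hx₀ hReach
  | succ i ih => exact (ih.succ hR hQP hReach hEntry).1

/-- Every goal is reached. -/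
theorem IsClosedLoop.exists_inGoal (hR : R.IsClosedLoop P H x₀ obs)
    (hs₀ : pos x₀ ∈ H.cell s₀) (hx₀ : x₀ ∈ P.equilibria (H.cell s₀) + P.E)
    (hQP : P.QPFeasibilityAssumption) (hReach : R.ReachabilityAssumption P H)
    (hEntry : R.NoEntryDuringContingency P H) (k : ℕ) :
    ∃ i, R.stage i = k ∧ R.InGoal P H (i + 1) k ∧ R.stage (i + 1) = k + 1 := by
  have hC := hR.consistent hs₀ hx₀ hQP hReach hEntry
  -- Induction on a bound for the rank: each period either enters the goal cell or lowers the rank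
  -- within the same stage.
  have progress : ∀ r i, rank P H R i ≤ r →
      ∃ j, R.stage j = R.stage i ∧ R.InGoal P H (j + 1) (R.stage i) ∧
        R.stage (j + 1) = R.stage i + 1 := by
    intro r
    induction r with
    | zero =>
      intro i hr
      rcases ((hC i).succ hR hQP hReach hEntry).2 with h | h
      · exact ⟨i, rfl, h⟩
      · omega
    | succ r ih =>
      intro i hr
      rcases ((hC i).succ hR hQP hReach hEntry).2 with h | ⟨h, h'⟩
      · exact ⟨i, rfl, h⟩
      · rw [← h]
        exact ih (i + 1) (by omega)
  induction k with
  | zero => simpa [hR.stage_zero] using progress _ 0 le_rfl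
  | succ k ih =>
    obtain ⟨i, -, -, hi⟩ := ih
    simpa [hi] using progress _ (i + 1) le_rfl

/-- Safety at the sampling times and admissibility of the input. -/
theorem IsClosedLoop.safe (hR : R.IsClosedLoop P H x₀ obs) {Xp : Set (Pos np)}
    (hs₀ : pos x₀ ∈ H.cell s₀) (hs₀_free : H.cell s₀ ⊆ Xp)
    (hx₀ : x₀ ∈ P.equilibria (H.cell s₀) + P.E)
    (hQP : P.QPFeasibilityAssumption) (hReach : R.ReachabilityAssumption P H)
    (hFree : R.FreeGoalAssumption P H Xp)
    (hEntry : R.NoEntryDuringContingency P H) (i : ℕ) :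
    (pos (R.x (i * P.T)) ∈ Xp ∧ rest (R.x (i * P.T)) ∈ P.Xq) ∧
      ∀ t ∈ Ico (i * P.T) ((i + 1) * P.T), R.ul t + R.um i ∈ P.U := by
  have hC := hR.consistent hs₀ hx₀ hQP hReach hEntry i
  have hfree : ∀ k ≤ R.stage i, (R.goalData H k).curr ∪ (R.goalData H k).goal ⊆ Xp := by
    intro k hk
    refine Set.union_subset ?_ (hFree k (hC.occurs k hk))
    cases k with
    | zero => simpa [goalData, hR.s_zero_eq hs₀] using hs₀_free
    | succ k =>
      -- The current cell of an update is the goal cell of its predecessor, hence free.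
      simp only [goalData]
      rw [hC.chain k (by omega)]
      exact hFree k (hC.occurs k (by omega))
  rcases hC.executes hR hQP with ⟨-, hX⟩ | ⟨-, -, -, hone, hX⟩
  · have := hX.constraints.mem_Xpq hC.one_le
    exact ⟨⟨hfree _ le_rfl this.1, this.2⟩, hX.input⟩
  · have := hX.constraints.mem_Xpq hone
    exact ⟨⟨hfree _ (Nat.sub_le _ _) this.1, this.2⟩, hX.input⟩

end Run

end MultiRate

/-! ### Identification of the law of a process -/

section TrajMeasure

variable {X : Type*} [Countable X] [MeasurableSpace X] [MeasurableSingletonClass X]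

/-- Atoms of a composition product. -/
theorem MeasureTheory.Measure.compProd_singleton {α β : Type*} [MeasurableSpace α]
    [MeasurableSpace β] [MeasurableSingletonClass α] [MeasurableSingletonClass β]
    (ν : Measure α) [SFinite ν] (κ : Kernel α β) [IsSFiniteKernel κ] (a : α) (b : β) :
    (ν ⊗ₘ κ) {(a, b)} = ν {a} * κ a {b} := by
  rw [← Set.singleton_prod_singleton, Measure.compProd_apply_prod (measurableSet_singleton a)
    (measurableSet_singleton b), lintegral_singleton, mul_comm]

/-- A process on a countable state space with the one-step conditional laws given by the kernels
`κ` has the law `trajMeasure`. -/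
theorem map_eq_trajMeasure {Ω : Type*} [MeasurableSpace Ω] {μ : Measure Ω}
    [IsProbabilityMeasure μ] {Y : ℕ → Ω → X} (hY : ∀ k, AEMeasurable (Y k) μ)
    {μ₀ : Measure X} [IsProbabilityMeasure μ₀]
    {κ : (n : ℕ) → Kernel ((_ : Finset.Iic n) → X) X} [∀ n, IsMarkovKernel (κ n)]
    (h0 : ∀ y, μ {ω | Y 0 ω = y} = μ₀ {y})
    (hstep : ∀ (n : ℕ) (w : ℕ → X), μ {ω | ∀ j ≤ n + 1, Y j ω = w j} =
      μ {ω | ∀ j ≤ n, Y j ω = w j} * κ n (Preorder.frestrictLe (π := fun _ => X) n w) {w (n + 1)}) :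
    μ.map (fun ω k => Y k ω) = Kernel.trajMeasure (X := fun _ => X) μ₀ κ := by
  have hYm : AEMeasurable (fun ω k => Y k ω) μ := aemeasurable_pi_iff.2 hY
  have : IsProbabilityMeasure (μ.map fun ω k => Y k ω) := Measure.isProbabilityMeasure_map hYm
  set τ := Kernel.trajMeasure (X := fun _ => X) μ₀ κ with hτ
  have hcyl : ∀ (n : ℕ) (w : ℕ → X), MeasurableSet {x : ℕ → X | ∀ j ≤ n, x j = w j} := by
    intro n w
    simp only [Set.ofPred_forall]
    exact MeasurableSet.iInter fun j => MeasurableSet.iInter fun _ =>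
      measurable_pi_apply j (measurableSet_singleton _)
  -- Both measures of a cylinder satisfy the same recursion; for `τ` it comes from the composition
  -- product of the law of a prefix with `κ n`.
  have key : ∀ (n : ℕ) (w : ℕ → X), μ {ω | ∀ j ≤ n, Y j ω = w j} = τ {x | ∀ j ≤ n, x j = w j} := by
    intro n
    induction n with
    | zero =>
      intro w
      simp only [Nat.le_zero, forall_eq]
      have h1 : ({x | x 0 = w 0} : Set (ℕ → X)) = (Preorder.frestrictLe (π := fun _ => X) 0) ⁻¹'
          {Preorder.frestrictLe (π := fun _ => X) 0 w} := by
        ext x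
        simp [funext_iff]
      have h2 : {w 0} = (MeasurableEquiv.piUnique fun _ : Finset.Iic 0 => X).symm ⁻¹'
          {Preorder.frestrictLe (π := fun _ => X) 0 w} := by
        ext y
        simp only [mem_preimage, mem_singleton_iff, MeasurableEquiv.symm_apply_eq]
        rfl
      rw [h0, h1, ← Measure.map_apply (by fun_prop) (measurableSet_singleton _), hτ,
        Kernel.trajMeasure, Measure.map_comp _ _ (by fun_prop), Kernel.traj_map_frestrictLe,
        Kernel.partialTraj_self, Measure.id_comp, Measure.map_apply (by fun_prop)
        (measurableSet_singleton _), h2]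
    | succ n ih =>
      intro w
      have h1 : ({x | ∀ j ≤ n + 1, x j = w j} : Set (ℕ → X)) =
          (fun x => (Preorder.frestrictLe (π := fun _ => X) n x, x (n + 1))) ⁻¹'
            {(Preorder.frestrictLe (π := fun _ => X) n w, w (n + 1))} := by
        ext x
        simp only [mem_ofPred_eq, mem_preimage, mem_singleton_iff, Prod.mk.injEq, funext_iff,
          Subtype.forall, Finset.mem_Iic, Preorder.frestrictLe_apply]
        constructor
        · exact fun h => ⟨fun j hj => h j (by omega), h _ le_rfl⟩
        · rintro ⟨h, h'⟩ j hj
          rcases Nat.lt_or_ge n j with hlt | hge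
          · obtain rfl : j = n + 1 := by omega
            exact h'
          · exact h j hge
      have h2 : ({x | ∀ j ≤ n, x j = w j} : Set (ℕ → X)) =
          (Preorder.frestrictLe (π := fun _ => X) n) ⁻¹' {Preorder.frestrictLe (π := fun _ => X) n w} := by
        ext x
        simp [funext_iff]
      rw [hstep, ih, h1, ← Measure.map_apply (by fun_prop) (measurableSet_singleton _),
        ← Kernel.map_frestrictLe_trajMeasure_compProd_eq_map_trajMeasure,
        Measure.compProd_singleton, h2,
        Measure.map_apply (by fun_prop) (measurableSet_singleton _)]
  have hmarg : ∀ n, (μ.map fun ω k => Y k ω).map (Preorder.frestrictLe (π := fun _ => X) n) =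
      τ.map (Preorder.frestrictLe (π := fun _ => X) n) := by
    intro n
    refine Measure.ext_of_singleton fun w => ?_
    -- Extends the finite word to a sequence; the entries beyond `n` are irrelevant.
    let w' : ℕ → X := fun j => w ⟨min j n, by simp⟩
    have h2 : (Preorder.frestrictLe (π := fun _ => X) n) ⁻¹' {w} = {x : ℕ → X | ∀ j ≤ n, x j = w' j} := by
      ext x
      simp only [mem_ofPred_eq, mem_preimage, mem_singleton_iff, funext_iff,
          Subtype.forall, Finset.mem_Iic, Preorder.frestrictLe_apply]
      refine forall₂_congr fun j hj => ?_
      simp [w', min_eq_left hj]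
    rw [Measure.map_apply (by fun_prop) (measurableSet_singleton _),
      Measure.map_apply (by fun_prop) (measurableSet_singleton _), h2,
      Measure.map_apply_of_aemeasurable hYm (hcyl n w'), ← key]
    rfl
  have hfam : IsProjectiveMeasureFamily (α := fun _ => X) fun I : Finset ℕ => τ.map I.restrict := by
    intro I J hJI
    rw [Measure.map_map (by fun_prop) (by fun_prop)]
    rfl
  have hlimτ : IsProjectiveLimit τ fun I : Finset ℕ => τ.map I.restrict := fun I => rfl
  -- On `ℕ`, agreement on initial segments gives agreement on all finite index sets, and a
  -- projective limit of finite measures is unique.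
  have hlim : IsProjectiveLimit (μ.map fun ω k => Y k ω) fun I : Finset ℕ => τ.map I.restrict :=
    (isProjectiveLimit_nat_iff hfam _).2 hmarg
  exact hlim.unique hlimτ

end TrajMeasure

namespace MultiRate

/-! ### The law of the closed loop -/

theorem historyList_congr {Y : Type*} {y y' : ℕ → Y} :
    ∀ {n : ℕ}, (∀ j ≤ n, y j = y' j) → historyList y n = historyList y' n
  | 0, h => by simp [historyList, h 0 le_rfl]
  | n + 1, h => by
    simp only [historyList, h (n + 1) le_rfl]
    rw [historyList_congr fun j hj => h j (by omega)]

theorem historyList_eq_cons {Y : Type*} (y : ℕ → Y) (n : ℕ) : ∃ l, historyList y n = y n :: l := by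
  cases n <;> exact ⟨_, rfl⟩

/-- Literals concern one coordinate in a countable space, and "until" is a countable union of
countable intersections. -/
theorem measurableSet_sat {S Z O AP : Type*} [Countable S] [Countable Z]
    [MeasurableSpace S] [MeasurableSpace Z] [MeasurableSpace O]
    [MeasurableSingletonClass S] [MeasurableSingletonClass Z]
    (label : AP → Set (S × Z)) (φ : SCLTL AP) (k : ℕ) :
    MeasurableSet {w : ℕ → S × Z × O | Sat label (fun k => ((w k).1, (w k).2.1)) φ k} := by
  have hatom : ∀ (k : ℕ) (B : Set (S × Z)),
      MeasurableSet {w : ℕ → S × Z × O | ((w k).1, (w k).2.1) ∈ B} := fun k B =>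
    (show Measurable fun w : ℕ → S × Z × O => ((w k).1, (w k).2.1) by fun_prop)
      (Set.to_countable B).measurableSet
  induction φ generalizing k with
  | atom p => exact hatom k _
  | natom p => exact hatom k (label p)ᶜ
  | and φ ψ h1 h2 => exact (h1 k).inter (h2 k)
  | or φ ψ h1 h2 => exact (h1 k).union (h2 k)
  | next φ h => exact h (k + 1)
  | untl φ ψ h1 h2 =>
    simp only [Sat, Set.ofPred_exists, Set.ofPred_and, Set.ofPred_forall]
    exact MeasurableSet.iUnion fun l => (MeasurableSet.const _).inter ((h2 l).inter
      (MeasurableSet.iInter fun j => MeasurableSet.iInter fun _ => MeasurableSet.iInter fun _ =>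
        h1 j))

namespace MOMDP

variable {S Z A O : Type*} (M : MOMDP S Z A O)

open Classical in
theorem stepLaw_apply (s : S) (z : Z) (a : A) (s' : S) (z' : Z) (o' : O) :
    M.stepLaw s z a (s', z', o') =
      if s' = M.fs s z a then M.Tz s z a s' z' * M.Obs s' z' a o' else 0 := by
  unfold stepLaw
  rw [PMF.bind_apply]
  split_ifs with h
  · subst h
    rw [tsum_eq_single z', PMF.map_apply, tsum_eq_single o']
    · simp
    · intro o'' ho
      simp [ho.symm]
    · intro z'' hz
      rw [PMF.map_apply]
      simp [hz.symm]
  · simp [PMF.map_apply, h]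

end MOMDP

namespace Run

variable {np nq nu : ℕ} {S Z A O : Type*} [Fintype Z]
  {P : Plant np nq nu} {H : HighLevel np S Z A O} {R : Run np nq nu S Z A}
  {x₀ : State np nq} {obs : ℕ → O} {s₀ : S}

/-- Along an execution that reaches all its goals, the observable state is the selected successor
and the actions are those of the belief-feedback policy. -/
theorem IsClosedLoop.high_level (hR : R.IsClosedLoop P H x₀ obs)
    (hs₀ : pos x₀ ∈ H.cell s₀) (hx₀ : x₀ ∈ P.equilibria (H.cell s₀) + P.E)
    (hQP : P.QPFeasibilityAssumption) (hReach : R.ReachabilityAssumption P H)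
    (hEntry : R.NoEntryDuringContingency P H) (k : ℕ) :
    R.Occurs P k ∧ R.s (k + 1) = R.snext k ∧
      R.a k = H.M.beliefPolicy s₀ H.b₀ H.πh (historyList (fun j => (R.s j, obs j)) k) := by
  have hC := hR.consistent hs₀ hx₀ hQP hReach hEntry
  have hG := hR.exists_inGoal hs₀ hx₀ hQP hReach hEntry
  have hocc : ∀ k, R.Occurs P k := fun k => by
    obtain ⟨i, hi, -⟩ := hG k
    exact ⟨i, (hC i).alive, hi⟩
  have hpol : ∀ k, R.b k = H.M.beliefAlong H.b₀ H.πh (historyList (fun j => (R.s j, obs j)) k) →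
      R.a k = H.M.beliefPolicy s₀ H.b₀ H.πh (historyList (fun j => (R.s j, obs j)) k) := by
    intro k hb
    obtain ⟨l, hl⟩ := historyList_eq_cons (fun j => (R.s j, obs j)) k
    rw [hR.action k (hocc k), hb, hl]
    rfl
  refine ⟨hocc k, ?_, hpol k ?_⟩
  · obtain ⟨i, -, -, hi⟩ := hG k
    exact (hC (i + 1)).chain k (by omega)
  -- The update that ends stage `k` performs exactly one step of the recursion defining
  -- `beliefAlong`.
  · induction k with
    | zero => rw [hR.b_zero]; rfl
    | succ k ih =>
      obtain ⟨i, rfl, hin, hi⟩ := hG k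
      obtain ⟨-, -, hb, -⟩ := hR.update i (hC (i + 1)).alive hin
      obtain ⟨l, hl⟩ := historyList_eq_cons (fun j => (R.s j, obs j)) (R.stage i)
      rw [hb, ih, hR.action _ (hocc _), ih]
      simp only [historyList, hl]
      rfl

end Run

section ClosedLoopLaw

variable {np nq nu : ℕ} {S Z A O Ω : Type*} [Fintype S] [Fintype Z] [Fintype O]
  [MeasurableSpace S] [MeasurableSpace Z] [MeasurableSpace O]
  [MeasurableSingletonClass S] [MeasurableSingletonClass Z] [MeasurableSingletonClass O]
  [MeasurableSpace Ω] {μ : Measure Ω} {P : Plant np nq nu} {H : HighLevel np S Z A O}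
  {s₀ : S} {o₀ : O} {R : Ω → Run np nq nu S Z A} {z : ℕ → Ω → Z} {o : ℕ → Ω → O} {π : Policy S A O}

/-- The observable states form an almost everywhere measurable process when they follow the
transition map under a policy. -/
theorem IsEnvironment.aemeasurable (hE : IsEnvironment P H o₀ μ R z o)
    (h0 : ∀ᵐ ω ∂μ, (R ω).s 0 = s₀)
    (hs : ∀ᵐ ω ∂μ, ∀ k, (R ω).s (k + 1) = H.M.fs ((R ω).s k) (z k ω)
      (π (historyList (fun j => ((R ω).s j, o j ω)) k))) (k : ℕ) :
    AEMeasurable (fun ω => ((R ω).s k, z k ω, o k ω)) μ := by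
  suffices h : AEMeasurable (fun ω => (R ω).s k) μ from
    h.prodMk ((hE.measurable_z k).aemeasurable.prodMk (hE.measurable_o k).aemeasurable)
  induction k using Nat.strong_induction_on with
  | _ k ih =>
    cases k with
    | zero => exact (aemeasurable_const (b := s₀)).congr (h0.mono fun ω h => h.symm)
    | succ k =>
      have hY : AEMeasurable (fun ω (j : Finset.Iic k) => ((R ω).s j, z j ω, o j ω)) μ :=
        aemeasurable_pi_iff.2 fun j =>
          (ih j (Nat.lt_succ_of_le (Finset.mem_Iic.1 j.2))).prodMk
            ((hE.measurable_z j).aemeasurable.prodMk (hE.measurable_o j).aemeasurable)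
      -- Measurability of `R` is not assumed: `s_{k+1}` is almost everywhere a function of the
      -- finite past, and any function on a countable discrete space is measurable. The `min` only
      -- keeps indices in range.
      let F : ((_ : Finset.Iic k) → S × Z × O) → S := fun h =>
        H.M.fs (h ⟨k, by simp⟩).1 (h ⟨k, by simp⟩).2.1
          (π (historyList (fun j => ((h ⟨min j k, by simp⟩).1, (h ⟨min j k, by simp⟩).2.2)) k))
      refine ((measurable_of_countable F).comp_aemeasurable hY).congr ?_
      filter_upwards [hs] with ω hω
      rw [hω k]
      simp only [Function.comp_apply, F]
      rw [historyList_congr fun j hj => ?_]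
      simp [min_eq_left hj]

/-- The law of the closed loop is the law of the MOMDP under the policy which selects its
actions. -/
theorem IsEnvironment.map_eq_law [IsProbabilityMeasure μ] (hE : IsEnvironment P H o₀ μ R z o)
    (h0 : ∀ᵐ ω ∂μ, (R ω).s 0 = s₀) (hocc : ∀ᵐ ω ∂μ, ∀ k, (R ω).Occurs P k)
    (ha : ∀ᵐ ω ∂μ, ∀ k, (R ω).a k = π (historyList (fun j => ((R ω).s j, o j ω)) k))
    (hs : ∀ᵐ ω ∂μ, ∀ k, (R ω).s (k + 1) = H.M.fs ((R ω).s k) (z k ω) ((R ω).a k)) :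
    AEMeasurable (fun ω k => ((R ω).s k, z k ω, o k ω)) μ ∧
      μ.map (fun ω k => ((R ω).s k, z k ω, o k ω)) = H.M.law s₀ H.b₀ o₀ π := by
  have hm := hE.aemeasurable (π := π) h0 (by
    filter_upwards [ha, hs] with ω h1 h2 k
    rw [h2, h1])
  refine ⟨aemeasurable_pi_iff.2 hm, map_eq_trajMeasure hm (fun y => ?_) fun n w => ?_⟩
  · obtain ⟨s', z', o'⟩ := y
    rw [PMF.toMeasure_apply_singleton _ _ (measurableSet_singleton _)]
    by_cases h : s' = s₀ ∧ o' = o₀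
    · obtain ⟨rfl, rfl⟩ := h
      rw [PMF.map_apply, tsum_eq_single z' fun z'' hz => by simp [hz.symm], if_pos rfl,
        ← hE.init_z z']
      refine measure_congr ?_
      filter_upwards [h0] with ω hω
      refine propext ⟨fun h => congrArg (fun y : S × Z × O => y.2.1) h, fun h => ?_⟩
      exact Prod.ext hω (Prod.ext h (hE.init_o ω))
    · have h1 : (H.b₀.map fun z => (s₀, z, o₀)) (s', z', o') = 0 := by
        rw [PMF.map_apply, ENNReal.tsum_eq_zero]
        intro z''
        rw [if_neg]
        rintro ⟨⟩
        exact h ⟨rfl, rfl⟩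
      rw [h1, measure_eq_zero_iff_ae_notMem]
      filter_upwards [h0] with ω hω hmem
      simp only [Prod.mk.injEq, hω, hE.init_o ω] at hmem
      exact h ⟨hmem.1.symm, hmem.2.2.symm⟩
  · classical
    set a := π (historyList (fun j => ((w j).1, (w j).2.2)) n) with ha_def
    have hker : H.M.stepKernel π n (Preorder.frestrictLe (π := fun _ => S × Z × O) n w)
        {w (n + 1)} = H.M.stepLaw (w n).1 (w n).2.1 a (w (n + 1)) := by
      change (PMF.toMeasure _ _) = _
      rw [PMF.toMeasure_apply_singleton _ _ (measurableSet_singleton _), ha_def,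
        historyList_congr (y' := fun j => ((w j).1, (w j).2.2)) fun j hj => ?_]
      · rfl
      · simp [min_eq_left hj]
    have hstep := hE.step n w a (w (n + 1)).1 (w (n + 1)).2.1 (w (n + 1)).2.2
    have haction : ∀ ω, (R ω).a n = π (historyList (fun j => ((R ω).s j, o j ω)) n) →
        (∀ j ≤ n, (R ω).s j = (w j).1 ∧ z j ω = (w j).2.1 ∧ o j ω = (w j).2.2) →
        (R ω).a n = a := fun ω h1 h2 => by
      rw [h1, ha_def, historyList_congr fun j hj => ?_]
      rw [(h2 j hj).1, (h2 j hj).2.2]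
    -- Almost surely the update occurs and the history fixes the action, so the extra conditions in
    -- `IsEnvironment.step` do not change the cylinder.
    have hlhs : μ {ω | ∀ j ≤ n + 1, ((R ω).s j, z j ω, o j ω) = w j} = μ {ω |
        ((R ω).Occurs P (n + 1) ∧
        (∀ j ≤ n, (R ω).s j = (w j).1 ∧ z j ω = (w j).2.1 ∧ o j ω = (w j).2.2) ∧
        (R ω).a n = a ∧ (R ω).s (n + 1) = (w (n + 1)).1) ∧
        z (n + 1) ω = (w (n + 1)).2.1 ∧ o (n + 1) ω = (w (n + 1)).2.2} := by
      refine measure_congr ?_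
      filter_upwards [hocc, ha] with ω h1 h2
      refine propext ⟨fun h => ?_, fun h => ?_⟩
      · have h' : ∀ j ≤ n + 1, (R ω).s j = (w j).1 ∧ z j ω = (w j).2.1 ∧ o j ω = (w j).2.2 :=
          fun j hj => by rw [← h j hj]; exact ⟨rfl, rfl, rfl⟩
        have h'' := h' (n + 1) le_rfl
        have h3 := fun j (hj : j ≤ n) => h' j (by omega)
        exact ⟨⟨h1 _, h3, haction ω (h2 n) h3, h''.1⟩, h''.2⟩
      · intro j hj
        rcases Nat.lt_or_ge n j with hlt | hge
        · obtain rfl : j = n + 1 := by omega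
          exact Prod.ext h.1.2.2.2 (Prod.ext h.2.1 h.2.2)
        · have h3 := h.1.2.1 j hge
          exact Prod.ext h3.1 (Prod.ext h3.2.1 h3.2.2)
    rw [hker, hlhs, hstep, H.M.stepLaw_apply]
    -- If `w` follows `f_s`, the conditioning event is almost surely the cylinder of length `n`.
    -- Otherwise the kernel gives mass zero and the conditioning event is null.
    split_ifs with hfs
    · congr 1
      refine measure_congr ?_
      filter_upwards [hocc, ha, hs] with ω h1 h2 h3
      refine propext ⟨fun h j hj => ?_, fun h => ?_⟩
      · have h4 := h.2.1 j hj
        exact Prod.ext h4.1 (Prod.ext h4.2.1 h4.2.2)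
      · have h' : ∀ j ≤ n, (R ω).s j = (w j).1 ∧ z j ω = (w j).2.1 ∧ o j ω = (w j).2.2 :=
          fun j hj => by rw [← h j hj]; exact ⟨rfl, rfl, rfl⟩
        have h5 := haction ω (h2 n) h'
        refine ⟨h1 _, h', h5, ?_⟩
        rw [h3 n, h5, (h' n le_rfl).1, (h' n le_rfl).2.1, hfs]
    · rw [mul_zero]
      refine mul_eq_zero_of_left ?_ _
      rw [measure_eq_zero_iff_ae_notMem]
      filter_upwards [hs] with ω h3 h
      obtain ⟨-, h', h5, h6⟩ := h
      exact hfs (by rw [← h6, h3 n, h5, (h' n le_rfl).1, (h' n le_rfl).2.1])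

end ClosedLoopLaw

end MultiRate

/-! ### Safety, progress and optimality of the closed loop -/

theorem theorem2 {np nq nu : ℕ} {S Z A O AP Ω : Type*}
    [Fintype S] [Fintype Z] [Fintype A] [Fintype O]
    [MeasurableSpace S] [MeasurableSpace Z] [MeasurableSpace O]
    [MeasurableSingletonClass S] [MeasurableSingletonClass Z] [MeasurableSingletonClass O]
    [MeasurableSpace Ω] (μ : MeasureTheory.Measure Ω) [MeasureTheory.IsProbabilityMeasure μ]
    (P : MultiRate.Plant np nq nu) (H : MultiRate.HighLevel np S Z A O)
    (Xp : Set (MultiRate.Pos np)) (label : AP → Set (S × Z)) (ψ : MultiRate.SCLTL AP)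
    (s₀ : S) (o₀ : O) (x₀ : MultiRate.State np nq)
    (Pol : Set (MultiRate.Policy S A O))
    (hπ_mem : H.M.beliefPolicy s₀ H.b₀ H.πh ∈ Pol)
    (hπ_max : ∀ π ∈ Pol, H.M.satProb label ψ s₀ H.b₀ o₀ π ≤
      H.M.satProb label ψ s₀ H.b₀ o₀ (H.M.beliefPolicy s₀ H.b₀ H.πh))
    (hs₀ : MultiRate.pos x₀ ∈ H.cell s₀) (hs₀_free : H.cell s₀ ⊆ Xp)
    (hx₀ : x₀ ∈ P.equilibria (H.cell s₀) + P.E)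
    (R : Ω → MultiRate.Run np nq nu S Z A) (z : ℕ → Ω → Z) (o : ℕ → Ω → O)
    (hR : ∀ ω, (R ω).IsClosedLoop P H x₀ (fun k => o k ω))
    (hE : MultiRate.IsEnvironment P H o₀ μ R z o)
    (hQP : P.QPFeasibilityAssumption)
    (hReach : ∀ᵐ ω ∂μ, (R ω).ReachabilityAssumption P H)
    (hFree : ∀ᵐ ω ∂μ, (R ω).FreeGoalAssumption P H Xp)
    (hEntry : ∀ᵐ ω ∂μ, (R ω).NoEntryDuringContingency P H) :
    (∀ᵐ ω ∂μ,
      (R ω).θ = ⊤ ∧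
      (∀ i, (R ω).CurFeasible P H i ∨ (R ω).PrevFeasible P H i) ∧
      (∀ i : ℕ, MultiRate.pos ((R ω).x (i * P.T)) ∈ Xp ∧ MultiRate.rest ((R ω).x (i * P.T)) ∈ P.Xq) ∧
      (∀ i : ℕ, ∀ t ∈ Set.Ico (i * P.T) ((i + 1) * P.T), (R ω).ul t + (R ω).um i ∈ P.U) ∧
      (∀ k, ∃ i, (R ω).stage i = k ∧ (R ω).InGoal P H (i + 1) k)) ∧
    ((∀ᵐ ω ∂μ, ∀ k, (R ω).Occurs P k →
        (R ω).snext k = H.M.fs ((R ω).s k) (z k ω) ((R ω).a k)) →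
      AEMeasurable (fun ω k => ((R ω).s k, z k ω, o k ω)) μ ∧
      μ.map (fun ω k => ((R ω).s k, z k ω, o k ω)) =
        H.M.law s₀ H.b₀ o₀ (H.M.beliefPolicy s₀ H.b₀ H.πh) ∧
      IsGreatest (H.M.satProb label ψ s₀ H.b₀ o₀ '' Pol)
        (μ {ω | MultiRate.Sat label (fun k => ((R ω).s k, z k ω)) ψ 0})) := by
  have hgood : ∀ᵐ ω ∂μ, (R ω).ReachabilityAssumption P H ∧
      (R ω).FreeGoalAssumption P H Xp ∧ (R ω).NoEntryDuringContingency P H := by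
    filter_upwards [hReach, hFree, hEntry] with ω h1 h2 h3 using ⟨h1, h2, h3⟩
  refine ⟨?_, fun hML => ?_⟩
  · filter_upwards [hgood] with ω ⟨h1, h2, h3⟩
    have hC := (hR ω).consistent hs₀ hx₀ hQP h1 h3
    have hsafe := (hR ω).safe hs₀ hs₀_free hx₀ hQP h1 h2 h3
    refine ⟨MultiRate.Run.θ_eq_top fun i => (hC i).alive,
      fun i => (hC i).feasible.imp_right And.left, fun i => (hsafe i).1, fun i => (hsafe i).2,
      fun k => ?_⟩
    obtain ⟨i, hi, hin, -⟩ := (hR ω).exists_inGoal hs₀ hx₀ hQP h1 h3 k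
    exact ⟨i, hi, hin⟩
  · have hhigh : ∀ᵐ ω ∂μ, ∀ k, (R ω).Occurs P k ∧ (R ω).s (k + 1) = (R ω).snext k ∧
        (R ω).a k = H.M.beliefPolicy s₀ H.b₀ H.πh
          (MultiRate.historyList (fun j => ((R ω).s j, o j ω)) k) := by
      filter_upwards [hgood] with ω ⟨h1, _, h3⟩ k
      exact (hR ω).high_level hs₀ hx₀ hQP h1 h3 k
    have hlaw := hE.map_eq_law (π := H.M.beliefPolicy s₀ H.b₀ H.πh)
      (Filter.Eventually.of_forall fun ω => (hR ω).s_zero_eq hs₀)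
      (hhigh.mono fun ω h k => (h k).1) (hhigh.mono fun ω h k => (h k).2.2) (by
        filter_upwards [hhigh, hML] with ω h h' k
        rw [(h k).2.1, h' k (h k).1])
    have hsat : μ {ω | MultiRate.Sat label (fun k => ((R ω).s k, z k ω)) ψ 0} =
        H.M.satProb label ψ s₀ H.b₀ o₀ (H.M.beliefPolicy s₀ H.b₀ H.πh) := by
      unfold MultiRate.MOMDP.satProb
      rw [← hlaw.2, MeasureTheory.Measure.map_apply_of_aemeasurable hlaw.1
        (MultiRate.measurableSet_sat label ψ 0)]
      rfl
    refine ⟨hlaw.1, hlaw.2, ?_⟩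
    rw [hsat]
    refine ⟨⟨_, hπ_mem, rfl⟩, ?_⟩
    rintro _ ⟨π, hπ, rfl⟩
    exact hπ_max π hπ
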